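/- Let the L-shape be the union of the three closed unit squares $[0,1]\times[0,1]$, $[1,2]\times[0,1]$ and $[0,1]\times[1,2]$ in the plane. The L-surface is obtained from the L-shape by identifying boundary edges by translations: $(x,0)\sim(x,2)$ for $0\le x\le 1$, $(x,0)\sim(x,1)$ for $1\le x\le 2$, $(0,y)\sim(2,y)$ for $0\le y\le 1$, and $(0,y)\sim(1,y)$ for $1\le y\le 2$. It carries the flat metric inherited from the plane, in which the distance of two points is the infimum of the lengths of the paths joining them. Its vertices are the images of the corners of the three squares (they are all identified to one point). A half-infinite geodesic that does not hit a vertex is a curve $\mathcal L(t)$, $t\ge 0$, avoiding the vertices, that moves along straight lines with a constant unit velocity vector. A real number is badly approximable if it is irrational and the digits $a_0,a_1,a_2,\ldots$ of its continued fraction $[a_0;a_1,a_2,\ldots]$ are bounded above by a constant. Theorem. If a half-infinite geodesic $\mathcal L(t)$, $t\ge 0$, on the L-surface that does not hit a vertex has a slope that is a badly approximable number, then it is superdense on the L-surface: there exists a constant $C=C(\mathcal L)>0$ such that, for every integer $n\ge 1$ and every point $P$ of the L-surface, there is a time $t$ with $0\le t\le Cn$ at which $\mathcal L(t)$ is at distance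 less than $1/n$ from $P$. -/

import Mathlib

namespace LSurf

/-- The Euclidean plane. -/
abbrev Plane : Type := EuclideanSpace ℝ (Fin 2)

/-- The closed unit square with lower left corner `(a, b)`. -/
def unitSquare (a b : ℝ) : Set Plane :=
  {p | p 0 ∈ Set.Icc a (a + 1) ∧ p 1 ∈ Set.Icc b (b + 1)}

/-- The L-shape: the union of three closed unit squares. -/
def LShape : Set Plane := unitSquare 0 0 ∪ unitSquare 1 0 ∪ unitSquare 0 1

/-- The identifications (all by translations) of the boundary edges of the L-shape. With the eight
boundary lattice points `A = (0,0)`, `B = (1,0)`, `C = (2,0)`, `D = (2,1)`, `E = (1,1)`,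
`F = (1,2)`, `G = (0,2)`, `H = (0,1)`, the edge `AB` is glued to `GF`, the edge `BC` to `ED`,
the edge `AH` to `CD` and the edge `HG` to `EF`. -/
inductive EdgeGlue : LShape → LShape → Prop
  | h1 (p q : LShape) (hp : p.1 0 ∈ Set.Icc (0 : ℝ) 1) (hp' : p.1 1 = 0)
      (hq : q.1 0 = p.1 0) (hq' : q.1 1 = 2) : EdgeGlue p q
  | h2 (p q : LShape) (hp : p.1 0 ∈ Set.Icc (1 : ℝ) 2) (hp' : p.1 1 = 0)
      (hq : q.1 0 = p.1 0) (hq' : q.1 1 = 1) : EdgeGlue p q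
  | v1 (p q : LShape) (hp : p.1 1 ∈ Set.Icc (0 : ℝ) 1) (hp' : p.1 0 = 0)
      (hq : q.1 1 = p.1 1) (hq' : q.1 0 = 2) : EdgeGlue p q
  | v2 (p q : LShape) (hp : p.1 1 ∈ Set.Icc (1 : ℝ) 2) (hp' : p.1 0 = 0)
      (hq : q.1 1 = p.1 1) (hq' : q.1 0 = 1) : EdgeGlue p q

/-- The L-surface: the quotient of the L-shape by the equivalence relation generated by the edge
identifications. -/
def LSurface : Type := Quot EdgeGlue

/-- The point of the L-surface represented by a point of the L-shape. -/
def LSurface.mk (p : LShape) : LSurface := Quot.mk EdgeGlue p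

/-- The vertices: the points of the L-surface represented by corners of the three squares, which
are exactly the points of the L-shape with integer coordinates. -/
def IsVertex (x : LSurface) : Prop :=
  ∃ p : LShape, LSurface.mk p = x ∧ ∃ m n : ℤ, p.1 0 = m ∧ p.1 1 = n

/-- `BrokenLine x y l`: there is a broken line of total length `l` from `x` to `y` on the
L-surface, each piece of which is the image of a straight line segment contained in the L-shape. -/
inductive BrokenLine (x : LSurface) : LSurface → ℝ → Prop
  | refl : BrokenLine x x 0
  | step (p q : LShape) (l : ℝ) (h : BrokenLine x (LSurface.mk p) l)
      (hpq : segment ℝ p.1 q.1 ⊆ LShape) : BrokenLine x (LSurface.mk q) (l + dist p.1 q.1)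

/-- The distance of the flat metric of the L-surface: the infimum of the lengths of the broken
lines that join two points. -/
noncomputable def flatDist (x y : LSurface) : ℝ := sInf {l : ℝ | BrokenLine x y l}

theorem BrokenLine.nonneg {x y : LSurface} {l : ℝ} (h : BrokenLine x y l) : 0 ≤ l := by
  induction h with
  | refl => exact le_rfl
  | step p q l _ _ ih => exact add_nonneg ih dist_nonneg

theorem zero_mem_LShape : (0 : Plane) ∈ LShape := by
  simp [LShape, unitSquare]

theorem smul_mem_LShape {p : Plane} (hp : p ∈ LShape) {c : ℝ} (h0 : 0 ≤ c) (h1 : c ≤ 1) :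
    c • p ∈ LShape := by
  have key : ∀ a : ℝ, 0 ≤ a → 0 ≤ c * a ∧ c * a ≤ a :=
    fun a ha => ⟨mul_nonneg h0 ha, mul_le_of_le_one_left ha h1⟩
  have hx : 0 ≤ p 0 ∧ 0 ≤ p 1 := by
    rcases hp with (⟨⟨h, _⟩, ⟨h', _⟩⟩ | ⟨⟨h, _⟩, ⟨h', _⟩⟩) | ⟨⟨h, _⟩, ⟨h', _⟩⟩ <;>
      constructor <;> linarith
  obtain ⟨a0, a1⟩ := key _ hx.1
  obtain ⟨b0, b1⟩ := key _ hx.2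
  simp only [LShape, unitSquare, Set.mem_union, Set.mem_ofPred_eq, Set.mem_Icc, PiLp.smul_apply,
    smul_eq_mul] at hp ⊢
  rcases hp with (h | h) | h
  · refine Or.inl (Or.inl ?_)
    refine ⟨⟨?_, ?_⟩, ?_, ?_⟩ <;> linarith [h.1.1, h.1.2, h.2.1, h.2.2]
  · rcases le_total (c * p 0) 1 with h' | h'
    · refine Or.inl (Or.inl ?_)
      refine ⟨⟨?_, ?_⟩, ?_, ?_⟩ <;> linarith [h.1.1, h.1.2, h.2.1, h.2.2]
    · refine Or.inl (Or.inr ?_)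
      refine ⟨⟨?_, ?_⟩, ?_, ?_⟩ <;> linarith [h.1.1, h.1.2, h.2.1, h.2.2]
  · rcases le_total (c * p 1) 1 with h' | h'
    · refine Or.inl (Or.inl ?_)
      refine ⟨⟨?_, ?_⟩, ?_, ?_⟩ <;> linarith [h.1.1, h.1.2, h.2.1, h.2.2]
    · refine Or.inr ?_
      refine ⟨⟨?_, ?_⟩, ?_, ?_⟩ <;> linarith [h.1.1, h.1.2, h.2.1, h.2.2]

/-- Any two points of the L-surface are joined by a broken line, so that the infimum in `flatDist`
is over a nonempty set of nonnegative numbers. -/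
theorem exists_brokenLine (x y : LSurface) : ∃ l : ℝ, BrokenLine x y l := by
  induction x using Quot.ind with
  | mk p =>
  induction y using Quot.ind with
  | mk q =>
  have seg : ∀ r : LShape, segment ℝ (0 : Plane) r.1 ⊆ LShape := by
    rintro r z ⟨a, b, ha, hb, hab, rfl⟩
    rw [smul_zero, zero_add]
    exact smul_mem_LShape r.2 hb (by linarith)
  have s1 := BrokenLine.step p ⟨0, zero_mem_LShape⟩ 0 (BrokenLine.refl (x := LSurface.mk p))
    (by rw [segment_symm]; exact seg p)
  exact ⟨_, BrokenLine.step _ q _ s1 (seg q)⟩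

/-- `IsGeodesic γ v`: the curve `γ t`, `t ≥ 0`, is a half-infinite geodesic of the L-surface with
constant unit velocity vector `v` (so parametrized by arc length): immediately after, and
immediately before, every time it is a straight line segment in the L-shape traversed with velocity
`v`. The starting points of the two segments may be different representatives of `γ t`: this is
how the curve crosses an edge. The values `γ t` for `t < 0` play no role. The notion is meant for
curves that avoid the vertices. -/
structure IsGeodesic (γ : ℝ → LSurface) (v : Plane) : Prop where
  unit_speed : ‖v‖ = 1
  forward : ∀ t : ℝ, 0 ≤ t → ∃ ε : ℝ, 0 < ε ∧ ∃ p : Plane, ∀ s ∈ Set.Icc (0 : ℝ) ε,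
    ∃ h : p + s • v ∈ LShape, γ (t + s) = LSurface.mk ⟨p + s • v, h⟩
  backward : ∀ t : ℝ, 0 < t → ∃ ε : ℝ, 0 < ε ∧ ε ≤ t ∧ ∃ p : Plane, ∀ s ∈ Set.Icc (0 : ℝ) ε,
    ∃ h : p - s • v ∈ LShape, γ (t - s) = LSurface.mk ⟨p - s • v, h⟩

/-- The vector `v` has slope `α`. -/
def HasSlope (v : Plane) (α : ℝ) : Prop := v 0 ≠ 0 ∧ v 1 / v 0 = α

/-- A real number is badly approximable if it is irrational and the digits `a₀, a₁, a₂, …` of its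
continued fraction are bounded above by a constant `A`. -/
def BadlyApproximable (α : ℝ) : Prop :=
  Irrational α ∧ ∃ A : ℝ, (GenContFract.of α).h ≤ A ∧
    ∀ (i : ℕ) (a : ℝ), (GenContFract.of α).partDens.get? i = some a → a ≤ A

/-- The half-infinite curve `γ t`, `t ≥ 0`, is superdense: for some constant `C > 0`, for every
integer `n ≥ 1`, the initial segment `γ t`, `0 ≤ t ≤ C n`, gets `(1/n)`-close to every point of the
L-surface. -/
def IsSuperdense (γ : ℝ → LSurface) : Prop :=
  ∃ C : ℝ, 0 < C ∧ ∀ n : ℕ, 1 ≤ n → ∀ x : LSurface,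
    ∃ t : ℝ, 0 ≤ t ∧ t ≤ C * n ∧ flatDist (γ t) x < 1 / n

end LSurf

/-!
Project the L-surface to the unit torus by the coordinates modulo `1`: it is a threefold cover,
branched over one point. Cut it into vertical columns of unit width. A geodesic of slope `β` then
becomes an orbit of a skew product over the rotation by `β`: the height grows by `β` from column to
column, and the sheet changes by the permutation `crossPerm`, which depends on the integer part of
the height.

The paths from the vertex that return close to it close up to loops. A Farey pair, that is a basis
of the lattice `ℤ²` consisting of a point just below and a point just above the line of slope `β`,
gives two such loops (`closedPerm`). When the smaller of the two errors is added to the larger one,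
the monodromy of the new loop is the product of the old ones, because no lattice point lies in
between (`FareyPair.closedPerm_add_left`, `FareyPair.closedPerm_add_right`). Hence at every level
the two loops generate the whole monodromy group, which permutes the three sheets transitively
(`exists_fareyPair`).

Bad approximability means `|q β - p| ≥ c / q` (`BadlyApproximable.exists_le_abs`). Consequently a
path within `c / Q` of the vertex runs parallel to a path from the vertex for `Q` columns, and a
Farey pair of level `Q` has errors `O(1 / Q)`. So the set of sheets on which a given path passes
close to the vertex is mapped by both loops into the corresponding set for a coarser scale and a
longer time. Either the set grows or it is invariant under a transitive group; as there are only
three sheets, after two such steps every path of `O(Q)` columns has passed within `O(1 / Q)` of the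
vertex on all three sheets (`exists_sheetsNear_eq_univ`). A given target point is reached
approximately from the vertex along one of the sheets, which gives superdensity of the skew product
(`exists_sheetPerm_eq_and_abs_le`).

Finally, a geodesic that avoids the vertices is determined by its initial point and direction, since the
representatives of a point of an edge differ in the direction in which one can leave them
(`squareMk_inj`, `IsGeodesic.eq_columnMk`). So its column crossings are indeed given by the skew
product (`IsGeodesic.eq_columnMk_sheetPerm`).
-/

namespace LSurf

/-! ### Badly approximable numbers -/

/-- All partial quotients of `x`, the integer part included, are at most `A`. -/
def DigitsLE (A x : ℝ) : Prop :=
  (⌊x⌋ : ℝ) ≤ A ∧ ∀ (i : ℕ) (a : ℝ), (GenContFract.of x).partDens.get? i = some a → a ≤ A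

theorem fract_ne_zero_of_irrational {x : ℝ} (hx : Irrational x) : Int.fract x ≠ 0 := by
  intro h
  exact hx.ne_int ⌊x⌋ (by rw [← Int.self_sub_floor] at h; linarith)

theorem irrational_inv_fract {x : ℝ} (hx : Irrational x) : Irrational (Int.fract x)⁻¹ := by
  rw [irrational_inv_iff, ← Int.self_sub_floor]
  exact hx.sub_intCast _

theorem digitsLE_inv_fract {A x : ℝ} (hx : Irrational x)
    (h : ∀ (i : ℕ) (a : ℝ), (GenContFract.of x).partDens.get? i = some a → a ≤ A) :
    DigitsLE A (Int.fract x)⁻¹ := by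
  constructor
  · refine h 0 _ ?_
    refine GenContFract.partDen_eq_s_b (gp := ⟨1, (⌊(Int.fract x)⁻¹⌋ : ℝ)⟩) ?_
    exact GenContFract.of_s_head (fract_ne_zero_of_irrational hx)
  · intro i a hi
    refine h (i + 1) a ?_
    obtain ⟨gp, hgp, rfl⟩ := GenContFract.exists_s_b_of_partDen hi
    apply GenContFract.partDen_eq_s_b
    rw [GenContFract.of_s_succ, hgp]

/-- The best approximation property of the convergent `p'/q'`: if `p/q` is the preceding convergent
and the ratio of the errors is `-x`, then no denominator `k` below the next one, `⌊x⌋ q' + q`, gives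
a smaller error than `q'`. -/
theorem abs_le_abs_of_lt_next {α x : ℝ} {q q' p p' k n : ℤ} (hf : Int.fract x ≠ 0)
    (hx1 : 1 < x) (hq' : 1 ≤ q') (hdet : (q * p' - q' * p) ^ 2 = 1)
    (hδ : (q * α - p : ℝ) = -x * (q' * α - p')) (hk : 1 ≤ k) (hk' : k < ⌊x⌋ * q' + q) :
    |(q' * α - p' : ℝ)| ≤ |(k * α - n : ℝ)| := by
  set a := ⌊x⌋ with ha
  have hfx : Int.fract x = x - a := rfl
  have hf0 : 0 < Int.fract x := lt_of_le_of_ne (Int.fract_nonneg x) (Ne.symm hf)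
  have hf1 := Int.fract_lt_one x
  set D := q' * p - q * p' with hD
  have hDD : D * D = 1 := by rw [hD]; linear_combination hdet
  -- coordinates of `(k, n)` in the basis of the two convergents `q'` and `a q' + q`
  set u := D * (k * (a * p' + p) - n * (a * q' + q)) with hu
  set w := D * (q' * n - p' * k) with hw
  have e1 : k = u * q' + w * (a * q' + q) := by
    rw [hu, hw]; linear_combination (-k) * hDD + D * k * hD
  have e2 : n = u * p' + w * (a * p' + p) := by
    rw [hu, hw]; linear_combination (-n) * hDD + D * n * hD
  have key : (k * α - n : ℝ) = (u - w * Int.fract x) * (q' * α - p') := by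
    rw [hfx]
    have e1' : (k : ℝ) = u * q' + w * (a * q' + q) := by exact_mod_cast e1
    have e2' : (n : ℝ) = u * p' + w * (a * p' + p) := by exact_mod_cast e2
    rw [e1', e2']; linear_combination w * hδ
  have ha1 : 1 ≤ a := Int.le_floor.2 (by exact_mod_cast hx1.le)
  have hc : 1 ≤ |(u - w * Int.fract x : ℝ)| := by
    rcases lt_trichotomy w 0 with h | h | h
    · have hu1 : 1 ≤ u := by
        by_contra! hcon
        nlinarith
      have hu1' : (1 : ℝ) ≤ u := by exact_mod_cast hu1
      have h' : (w : ℝ) < 0 := by exact_mod_cast h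
      refine le_abs.2 (Or.inl ?_)
      nlinarith
    · rw [h]
      have : u ≠ 0 := by
        rintro h0
        rw [h0, h] at e1
        omega
      have := Int.one_le_abs this
      simp only [Int.cast_zero, zero_mul, sub_zero]
      exact_mod_cast this
    · have hu1 : u ≤ -1 := by
        by_contra! hcon
        nlinarith
      have hu1' : (u : ℝ) ≤ -1 := by exact_mod_cast hu1
      have h' : (0 : ℝ) < w := by exact_mod_cast h
      refine le_abs.2 (Or.inr ?_)
      nlinarith
  rw [key, abs_mul]
  exact le_mul_of_one_le_left (abs_nonneg _) hc

/-- The error of a convergent is at least `1 / ((A + 2) q')` if the next partial quotient is at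
most `A`. -/
theorem le_abs_error {A α x : ℝ} {q q' p p' : ℤ} (hx1 : 1 < x) (hA : (⌊x⌋ : ℝ) ≤ A)
    (hq : 0 ≤ q) (hqq : q ≤ q') (hq' : 1 ≤ q') (hdet : (q * p' - q' * p) ^ 2 = 1)
    (hδ : (q * α - p : ℝ) = -x * (q' * α - p')) :
    1 / ((A + 2) * q') ≤ |(q' * α - p' : ℝ)| := by
  have hq0 : (0 : ℝ) ≤ q := by exact_mod_cast hq
  have hqq' : (q : ℝ) ≤ q' := by exact_mod_cast hqq
  have hq1 : (1 : ℝ) ≤ q' := by exact_mod_cast hq'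
  have hxA : x < A + 1 := by linarith [Int.lt_floor_add_one x]
  have h1 : (q * p' - q' * p : ℝ) ^ 2 = 1 := by exact_mod_cast hdet
  have h2 : ((q + x * q') * (q' * α - p') : ℝ) ^ 2 = 1 := by
    rw [← h1]
    have : ((q + x * q') * (q' * α - p') : ℝ) = -(q * p' - q' * p) := by
      linear_combination q' * hδ
    rw [this]; ring
  have h3 : |((q + x * q') * (q' * α - p') : ℝ)| = 1 := by
    simpa using (sq_eq_sq_iff_abs_eq_abs _ 1).1 (h2.trans (one_pow 2).symm)
  have h4 : (0 : ℝ) < q + x * q' := by nlinarith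
  rw [abs_mul, abs_of_pos h4] at h3
  have h5 : (q + x * q' : ℝ) ≤ (A + 2) * q' := by nlinarith
  rw [div_le_iff₀ (lt_of_lt_of_le h4 h5), ← h3, mul_comm]
  exact mul_le_mul_of_nonneg_left h5 (abs_nonneg _)

/-- The lower bound for the errors of all denominators from `q'` on, by induction along the
continued fraction expansion. -/
theorem le_abs_mul_sub_of_consecutive {A α : ℝ} (k n : ℤ) (N : ℕ) :
    ∀ (q q' p p' : ℤ) (x : ℝ), Irrational x → 1 < x → DigitsLE A x → 0 ≤ q → q ≤ q' → 1 ≤ q' →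
      (q * p' - q' * p) ^ 2 = 1 → (q * α - p : ℝ) = -x * (q' * α - p') → q' ≤ k →
      2 * k - q - q' < N → 1 / ((A + 2) * k) ≤ |(k * α - n : ℝ)| := by
  induction N with
  | zero =>
    intro q q' p p' x hx hx1 hA hq hqq hq' hdet hδ hk hN
    push_cast at hN
    omega
  | succ N ih =>
    intro q q' p p' x hx hx1 hA hq hqq hq' hdet hδ hk hN
    have hf := fract_ne_zero_of_irrational hx
    have hf0 : 0 < Int.fract x := lt_of_le_of_ne (Int.fract_nonneg x) (Ne.symm hf)
    have ha1 : 1 ≤ ⌊x⌋ := Int.le_floor.2 (by exact_mod_cast hx1.le)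
    have ha1' : (1 : ℝ) ≤ ⌊x⌋ := by exact_mod_cast ha1
    rcases lt_or_ge k (⌊x⌋ * q' + q) with hk' | hk'
    · refine le_trans ?_ ((le_abs_error hx1 hA.1 hq hqq hq' hdet hδ).trans
        (abs_le_abs_of_lt_next (n := n) hf hx1 hq' hdet hδ (by omega) hk'))
      have h1 : (1 : ℝ) ≤ q' := by exact_mod_cast hq'
      have h2 : (q' : ℝ) ≤ k := by exact_mod_cast hk
      have h3 : 0 < A + 2 := by linarith [hA.1]
      have h4 : (0 : ℝ) < (A + 2) * q' := by positivity
      exact one_div_le_one_div_of_le h4 (mul_le_mul_of_nonneg_left h2 h3.le)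
    · have hmul : q' ≤ ⌊x⌋ * q' := le_mul_of_one_le_left (by omega) ha1
      refine ih q' (⌊x⌋ * q' + q) p' (⌊x⌋ * p' + p) (Int.fract x)⁻¹ (irrational_inv_fract hx)
        ((one_lt_inv₀ hf0).2 (Int.fract_lt_one x)) (digitsLE_inv_fract hx hA.2) (by omega)
        (by omega) (by omega) ?_ ?_ hk' ?_
      · rw [← hdet]; ring
      · have hfx : Int.fract x = x - ⌊x⌋ := rfl
        push_cast
        field_simp
        rw [hfx]
        linear_combination hδ
      · push_cast at hN
        omega

/-- A badly approximable number satisfies `|q α - p| ≥ c / q` for all integers `p` and `q ≥ 1`. -/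
theorem BadlyApproximable.exists_le_abs {α : ℝ} (h : BadlyApproximable α) :
    ∃ c : ℝ, 0 < c ∧ ∀ (q p : ℤ), 1 ≤ q → c / q ≤ |q * α - p| := by
  obtain ⟨hirr, A, -, hA⟩ := h
  have hf := fract_ne_zero_of_irrational hirr
  have hf0 : 0 < Int.fract α := lt_of_le_of_ne (Int.fract_nonneg α) (Ne.symm hf)
  have h1 : 1 < (Int.fract α)⁻¹ := (one_lt_inv₀ hf0).2 (Int.fract_lt_one α)
  have hD := digitsLE_inv_fract hirr hA
  have hA0 : 0 < A + 2 := by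
    have : (1 : ℝ) ≤ ⌊(Int.fract α)⁻¹⌋ := by
      exact_mod_cast Int.le_floor.2 (by exact_mod_cast h1.le)
    linarith [hD.1]
  refine ⟨1 / (A + 2), by positivity, fun q p hq => ?_⟩
  rw [div_div]
  refine le_abs_mul_sub_of_consecutive q p (2 * q).toNat 0 1 1 ⌊α⌋ _ (irrational_inv_fract hirr) h1
    hD le_rfl zero_le_one le_rfl (by ring) ?_ hq (by omega)
  have hfx : Int.fract α = α - ⌊α⌋ := rfl
  push_cast
  field_simp
  rw [hfx]
  ring

/-! ### The monodromy cocycle over a rotation -/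

/-- The permutation of the three squares that takes a square to its right-hand neighbour. Square
`0` is the corner of the L-shape, square `1` is the right one and square `2` the top one. -/
def rightPerm : Equiv.Perm (Fin 3) := Equiv.swap 0 1

/-- The permutation of the three squares that takes a square to its upper neighbour. -/
def upPerm : Equiv.Perm (Fin 3) := Equiv.swap 0 2

/-- The permutation of the sheets of a vertical column of unit width on crossing its right-hand
side at a height in `(n, n + 1)`: go up `n` squares, then right, then down `n` squares. The sheets
of a column are named by the square in which they meet the heights in `(0, 1)`. As
`rightPerm` is an involution, so is this one: it also describes the crossings to the left. -/
def crossPerm (n : ℤ) : Equiv.Perm (Fin 3) := upPerm ^ (-n) * rightPerm * upPerm ^ n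

/-- The permutation of the sheets along a path of slope `β` that crosses `k` columns, starting at
height `y` on the left-hand side of the first one. -/
noncomputable def sheetPerm (β y : ℝ) : ℕ → Equiv.Perm (Fin 3)
  | 0 => 1
  | k + 1 => crossPerm ⌊y + (k + 1) * β⌋ * sheetPerm β y k

theorem sheetPerm_add (β y : ℝ) (a b : ℕ) :
    sheetPerm β y (a + b) = sheetPerm β (y + a * β) b * sheetPerm β y a := by
  induction b with
  | zero => simp [sheetPerm]
  | succ b ih =>
    rw [← add_assoc, sheetPerm, sheetPerm, ih, mul_assoc]
    congr 3
    push_cast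
    ring

theorem crossPerm_add (m n : ℤ) : upPerm ^ n * crossPerm (n + m) = crossPerm m * upPerm ^ n := by
  simp only [crossPerm]
  group

/-- Paths that stay on the same side of all lattice points, up to a vertical translation by `n`,
have the same monodromy. -/
theorem sheetPerm_shadow {β y y' : ℝ} {n : ℤ} {k : ℕ}
    (h : ∀ l : ℕ, 1 ≤ l → l ≤ k → ⌊y + l * β⌋ = n + ⌊y' + l * β⌋) :
    upPerm ^ n * sheetPerm β y k = sheetPerm β y' k * upPerm ^ n := by
  induction k with
  | zero => simp [sheetPerm]
  | succ k ih =>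
    have h1 := h (k + 1) (by omega) le_rfl
    push_cast at h1
    rw [sheetPerm, sheetPerm, h1, ← mul_assoc, crossPerm_add, mul_assoc,
      ih fun l hl hl' => h l hl (by omega), mul_assoc]

/-- The monodromy of the closed path that follows a path of slope `β` from a vertex across `q`
columns and then closes up vertically to the lattice point at height `p`. -/
noncomputable def closedPerm (β : ℝ) (q : ℕ) (p : ℤ) : Equiv.Perm (Fin 3) :=
  upPerm ^ p * sheetPerm β 0 q

/-- Closed paths multiply if no lattice point separates the first one, shifted by the error of the
second one, from the unshifted one. -/
theorem closedPerm_add {β : ℝ} {q s : ℕ} {p p' : ℤ}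
    (h : ∀ l : ℕ, 1 ≤ l → l ≤ q → ⌊(s * β - p') + l * β⌋ = ⌊l * β⌋) :
    closedPerm β (s + q) (p + p') = closedPerm β q p * closedPerm β s p' := by
  have := sheetPerm_shadow (β := β) (y := 0 + s * β) (y' := 0) (n := p') (k := q) (by
    intro l hl hl'
    rw [zero_add (l * β), ← h l hl hl', add_comm p', ← Int.floor_add_intCast]
    congr 1
    ring)
  rw [closedPerm, closedPerm, closedPerm, sheetPerm_add, zpow_add, mul_assoc, mul_assoc,
    ← mul_assoc (upPerm ^ p'), this]
  simp only [mul_assoc]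

/-! ### Farey pairs -/

/-- Two lattice points `(q₁, p₁)` and `(q₂, p₂)`, the first one below and the second one above the
line of slope `β` through the origin, that span the lattice. -/
structure FareyPair (β : ℝ) (q₁ q₂ : ℕ) (p₁ p₂ : ℤ) : Prop where
  one_le_left : 1 ≤ q₁
  one_le_right : 1 ≤ q₂
  det : (q₁ : ℤ) * p₂ - q₂ * p₁ = 1
  left_pos : 0 < q₁ * β - p₁
  right_neg : q₂ * β - p₂ < 0

namespace FareyPair

variable {β : ℝ} {q₁ q₂ : ℕ} {p₁ p₂ : ℤ}

/-- No lattice point with abscissa in `[1, q₁ + q₂)` lies nearer to the line than the point of the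
pair on the same side. -/
theorem le_or_le (h : FareyPair β q₁ q₂ p₁ p₂) {k : ℕ} (hk : 1 ≤ k) (hk' : k < q₁ + q₂) (n : ℤ) :
    q₁ * β - p₁ ≤ k * β - n ∨ k * β - n ≤ q₂ * β - p₂ := by
  obtain ⟨h1, h2, hdet, h3, h4⟩ := h
  set x : ℤ := k * p₂ - n * q₂ with hx
  set z : ℤ := q₁ * n - p₁ * k with hz
  have e1 : (k : ℤ) = x * q₁ + z * q₂ := by
    rw [hx, hz]; linear_combination (-k : ℤ) * hdet
  have e2 : n = x * p₁ + z * p₂ := by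
    rw [hx, hz]; linear_combination (-n : ℤ) * hdet
  have e1' : (k : ℝ) = x * q₁ + z * q₂ := by exact_mod_cast e1
  have e2' : (n : ℝ) = x * p₁ + z * p₂ := by exact_mod_cast e2
  have key : (k * β - n : ℝ) = x * (q₁ * β - p₁) + z * (q₂ * β - p₂) := by
    rw [e1', e2']; ring
  rcases le_or_gt x 0 with hx0 | hx0
  · right
    have hz1 : 1 ≤ z := by
      by_contra! hcon
      have : z * q₂ ≤ 0 := mul_nonpos_of_nonpos_of_nonneg (by omega) (by positivity)
      have : x * q₁ ≤ 0 := mul_nonpos_of_nonpos_of_nonneg hx0 (by positivity)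
      omega
    have hx0' : (x : ℝ) ≤ 0 := by exact_mod_cast hx0
    have hz1' : (1 : ℝ) ≤ z := by exact_mod_cast hz1
    rw [key]
    nlinarith
  · left
    have hz0 : z ≤ 0 := by
      by_contra! hcon
      have : (q₂ : ℤ) ≤ z * q₂ := le_mul_of_one_le_left (by positivity) hcon
      have : (q₁ : ℤ) ≤ x * q₁ := le_mul_of_one_le_left (by positivity) hx0
      omega
    have hx0' : (1 : ℝ) ≤ x := by exact_mod_cast hx0
    have hz1' : (z : ℝ) ≤ 0 := by exact_mod_cast hz0
    rw [key]
    nlinarith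

/-- If the sum of the two points lies below the line, its monodromy is the product of theirs. -/
theorem closedPerm_add_left (h : FareyPair β q₁ q₂ p₁ p₂)
    (hs : 0 < (q₁ * β - p₁) + (q₂ * β - p₂)) :
    closedPerm β (q₂ + q₁) (p₁ + p₂) = closedPerm β q₁ p₁ * closedPerm β q₂ p₂ := by
  refine closedPerm_add fun l hl hl' => Int.floor_eq_iff.2 ?_
  have h1 := Int.floor_le (l * β)
  have h2 := Int.lt_floor_add_one (l * β)
  have h3 := h.right_neg
  rcases h.le_or_le hl (by have := h.one_le_right; omega) ⌊l * β⌋ with h4 | h4 <;>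
    constructor <;> linarith

/-- If the sum of the two points lies above the line, its monodromy is the product of theirs. -/
theorem closedPerm_add_right (h : FareyPair β q₁ q₂ p₁ p₂)
    (hs : (q₁ * β - p₁) + (q₂ * β - p₂) < 0) :
    closedPerm β (q₁ + q₂) (p₂ + p₁) = closedPerm β q₂ p₂ * closedPerm β q₁ p₁ := by
  refine closedPerm_add fun l hl hl' => Int.floor_eq_iff.2 ?_
  have h1 := Int.floor_le (l * β)
  have h2 := Int.lt_floor_add_one (l * β)
  have h3 := h.left_pos
  rcases h.le_or_le hl (by have := h.one_le_left; omega) (⌊l * β⌋ + 1) with h4 | h4 <;>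
    push_cast at h4 <;> constructor <;> linarith

/-- Every line of slope `β` passes near a lattice point with abscissa in `[0, q₁ + q₂]`, found by
rounding down the coordinates of a point of the plane in the basis given by the pair. -/
theorem exists_near (h : FareyPair β q₁ q₂ p₁ p₂) (y : ℝ) :
    ∃ (k : ℕ) (n : ℤ), k ≤ q₁ + q₂ ∧ |y + k * β - n| ≤ (q₁ * β - p₁) - (q₂ * β - p₂) := by
  obtain ⟨h1, h2, hdet, h3, h4⟩ := h
  have hdet' : (q₁ * p₂ - q₂ * p₁ : ℝ) = 1 := by exact_mod_cast hdet
  -- coordinates of the real point with abscissa `q₁ + q₂` at height `-y` over the line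
  set X : ℝ := -(q₁ + q₂) * (q₂ * β - p₂) - y * q₂ with hX
  set Z : ℝ := (q₁ + q₂) * (q₁ * β - p₁) + y * q₁ with hZ
  have e1 : (q₁ + q₂ : ℝ) = X * q₁ + Z * q₂ := by
    rw [hX, hZ]; linear_combination (-(q₁ + q₂) : ℝ) * hdet'
  have e2 : -y = X * (q₁ * β - p₁) + Z * (q₂ * β - p₂) := by
    rw [hX, hZ]; linear_combination y * hdet'
  have x1 := Int.floor_le X
  have x2 := Int.lt_floor_add_one X
  have z1 := Int.floor_le Z
  have z2 := Int.lt_floor_add_one Z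
  have hq1 : (1 : ℝ) ≤ q₁ := by exact_mod_cast h1
  have hq2 : (1 : ℝ) ≤ q₂ := by exact_mod_cast h2
  set k : ℤ := ⌊X⌋ * q₁ + ⌊Z⌋ * q₂ with hk
  have hk' : (k : ℝ) = ⌊X⌋ * q₁ + ⌊Z⌋ * q₂ := by rw [hk]; push_cast; ring
  have hk0 : 0 ≤ k := by
    have : (0 : ℝ) ≤ k := by rw [hk']; nlinarith
    exact_mod_cast this
  have hk1 : k ≤ q₁ + q₂ := by
    have : (k : ℝ) ≤ q₁ + q₂ := by rw [hk']; nlinarith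
    exact_mod_cast this
  refine ⟨k.toNat, ⌊X⌋ * p₁ + ⌊Z⌋ * p₂, by omega, ?_⟩
  have hkk : ((k.toNat : ℕ) : ℝ) = k := by
    have : ((k.toNat : ℕ) : ℤ) = k := Int.toNat_of_nonneg hk0
    exact_mod_cast this
  have key : y + (k.toNat : ℕ) * β - ((⌊X⌋ * p₁ + ⌊Z⌋ * p₂ : ℤ) : ℝ) =
      -((X - ⌊X⌋) * (q₁ * β - p₁) + (Z - ⌊Z⌋) * (q₂ * β - p₂)) := by
    rw [hkk, hk']; push_cast; linear_combination -e2
  rw [key, abs_neg, abs_le]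
  constructor <;> nlinarith

/-- With the lower bound `c / q` for all errors, a pair with large `q₁ + q₂` has small errors on
both sides. -/
theorem error_le (h : FareyPair β q₁ q₂ p₁ p₂) {c : ℝ} (hc : 0 < c)
    (hβ : ∀ (q p : ℤ), 1 ≤ q → c / q ≤ |q * β - p|) {Q : ℕ} (h1 : q₁ ≤ Q)
    (hQ : Q < q₁ + q₂) : q₁ * β - p₁ ≤ 2 / (c * Q) ∧ -(q₂ * β - p₂) ≤ 2 / (c * Q) := by
  have hdet' : (q₁ * p₂ - q₂ * p₁ : ℝ) = 1 := by exact_mod_cast h.det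
  have hl := h.left_pos
  have hr := h.right_neg
  have a1 : (1 : ℝ) ≤ q₁ := by exact_mod_cast h.one_le_left
  have a2 : (1 : ℝ) ≤ q₂ := by exact_mod_cast h.one_le_right
  have hQ' : (Q : ℝ) ≤ q₁ + q₂ := by exact_mod_cast hQ.le
  have hQ0 : (0 : ℝ) < Q := lt_of_lt_of_le one_pos (a1.trans (by exact_mod_cast h1))
  have b1 := hβ q₁ p₁ (by exact_mod_cast h.one_le_left)
  have b2 := hβ q₂ p₂ (by exact_mod_cast h.one_le_right)
  rw [Int.cast_natCast, abs_of_pos hl, div_le_iff₀ (by linarith)] at b1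
  rw [Int.cast_natCast, abs_of_neg hr, div_le_iff₀ (by linarith)] at b2
  set d := q₁ * β - p₁ with hd
  set e := -(q₂ * β - p₂) with he
  have he0 : 0 < e := by linarith
  -- the determinant in terms of the errors
  have hone : q₁ * e + q₂ * d = 1 := by rw [hd, he]; linear_combination hdet'
  have c1 : q₂ * d ≤ 1 := by nlinarith
  have c2 : q₁ * e ≤ 1 := by nlinarith
  have hc1 : c ≤ 1 := by
    have := hβ 1 ⌊β⌋ le_rfl
    have h1 := Int.floor_le β
    have h2 := Int.lt_floor_add_one β
    rw [Int.cast_one, div_one, one_mul, abs_of_nonneg (by linarith)] at this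
    linarith
  have hprod : (q₂ * d) * (q₁ * e) ≤ 1 :=
    mul_le_one₀ c1 (by positivity) c2
  constructor
  · rw [le_div_iff₀ (by positivity)]
    calc d * (c * Q) ≤ d * (c * (q₁ + q₂)) := by gcongr
      _ = c * (q₂ * d) + c * (q₁ * d) := by ring
      _ ≤ 1 * 1 + (e * q₂) * (q₁ * d) := by gcongr
      _ ≤ 2 := by linarith
  · rw [le_div_iff₀ (by positivity)]
    calc e * (c * Q) ≤ e * (c * (q₁ + q₂)) := by gcongr
      _ = c * (q₁ * e) + c * (q₂ * e) := by ring
      _ ≤ 1 * 1 + (d * q₁) * (q₂ * e) := by gcongr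
      _ ≤ 2 := by linarith

end FareyPair

/-- Every level `Q` has a Farey pair, and the monodromies of the pair generate the monodromy group
of the surface. -/
theorem exists_fareyPair {β : ℝ} (hβ : Irrational β) (Q : ℕ) (hQ : 1 ≤ Q) :
    ∃ (q₁ q₂ : ℕ) (p₁ p₂ : ℤ), FareyPair β q₁ q₂ p₁ p₂ ∧ q₁ ≤ Q ∧ q₂ ≤ Q ∧ Q < q₁ + q₂ ∧
      ∀ H : Subgroup (Equiv.Perm (Fin 3)), closedPerm β q₁ p₁ ∈ H → closedPerm β q₂ p₂ ∈ H →
        upPerm ∈ H ∧ rightPerm ∈ H := by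
  induction Q, hQ using Nat.le_induction with
  | base =>
    have h0 := fract_ne_zero_of_irrational hβ
    have h1 : 0 < Int.fract β := lt_of_le_of_ne (Int.fract_nonneg β) (Ne.symm h0)
    have h2 := Int.fract_lt_one β
    rw [← Int.self_sub_floor] at h1 h2
    refine ⟨1, 1, ⌊β⌋, ⌊β⌋ + 1, ⟨le_rfl, le_rfl, by ring, ?_, ?_⟩, le_rfl, le_rfl, by norm_num, ?_⟩
    · simpa using h1
    · push_cast; linarith
    · intro H hG1 hG2
      have e1 : closedPerm β 1 ⌊β⌋ = rightPerm * upPerm ^ ⌊β⌋ := by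
        simp [closedPerm, sheetPerm, crossPerm, mul_assoc]
      have e2 : closedPerm β 1 (⌊β⌋ + 1) = upPerm * closedPerm β 1 ⌊β⌋ := by
        rw [closedPerm, closedPerm, add_comm, zpow_add, zpow_one, mul_assoc]
      have hu : upPerm ∈ H := by
        rw [e2] at hG2
        exact (Subgroup.mul_mem_cancel_right H hG1).1 hG2
      refine ⟨hu, ?_⟩
      rw [e1] at hG1
      exact (Subgroup.mul_mem_cancel_right H (H.zpow_mem hu _)).1 hG1
  | succ Q hQ ih =>
    obtain ⟨q₁, q₂, p₁, p₂, hF, h1, h2, h3, hgen⟩ := ih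
    rcases Nat.lt_or_ge (Q + 1) (q₁ + q₂) with h4 | h4
    · exact ⟨q₁, q₂, p₁, p₂, hF, by omega, by omega, h4, hgen⟩
    have a1 := hF.one_le_left
    have a2 := hF.one_le_right
    have hdet := hF.det
    have hne : (q₁ * β - p₁) + (q₂ * β - p₂) ≠ 0 := by
      intro h0
      have h5 : ((q₁ + q₂ : ℕ) : ℝ) * β = ((p₁ + p₂ : ℤ) : ℝ) := by push_cast; linarith
      exact (hβ.natCast_mul (by omega : q₁ + q₂ ≠ 0)).ne_int _ h5
    rcases lt_or_gt_of_ne hne with hs | hs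
    · refine ⟨q₁, q₁ + q₂, p₁, p₂ + p₁, ⟨a1, by omega, ?_, hF.left_pos, ?_⟩, by omega, by omega,
        by omega, ?_⟩
      · push_cast; linear_combination hdet
      · push_cast; linarith
      · intro H hG1 hG2
        rw [hF.closedPerm_add_right hs] at hG2
        exact hgen H hG1 ((Subgroup.mul_mem_cancel_right H hG1).1 hG2)
    · refine ⟨q₂ + q₁, q₂, p₁ + p₂, p₂, ⟨by omega, a2, ?_, ?_, hF.right_neg⟩, by omega, by omega,
        by omega, ?_⟩
      · push_cast; linear_combination hdet
      · push_cast; linarith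
      · intro H hG1 hG2
        rw [hF.closedPerm_add_left hs] at hG1
        exact hgen H ((Subgroup.mul_mem_cancel_right H hG2).1 hG1) hG2

/-! ### Quantitative density of the skew product -/

open scoped Pointwise in
theorem eq_univ_of_upPerm_rightPerm {B : Set (Fin 3)} (hne : B.Nonempty)
    (hu : upPerm ∈ MulAction.stabilizer (Equiv.Perm (Fin 3)) B)
    (hr : rightPerm ∈ MulAction.stabilizer (Equiv.Perm (Fin 3)) B) : B = Set.univ := by
  rw [MulAction.mem_stabilizer_set] at hu hr
  have u0 := hu 0
  have r0 := hr 0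
  rw [show upPerm • (0 : Fin 3) = 2 from rfl] at u0
  rw [show rightPerm • (0 : Fin 3) = 1 from rfl] at r0
  have h0 : (0 : Fin 3) ∈ B := by
    obtain ⟨j, hj⟩ := hne
    fin_cases j
    · exact hj
    · exact r0.1 hj
    · exact u0.1 hj
  refine Set.eq_univ_of_forall fun j => ?_
  fin_cases j
  · exact h0
  · exact r0.2 h0
  · exact u0.2 h0

/-- The sheets on which the path of slope `β` that starts on the sheet `i` at height `y` passes
within `ε` of a vertex while it crosses the first `T` columns. A sheet near the lattice point at
height `n` is named as seen from that height. -/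
def sheetsNear (β y : ℝ) (i : Fin 3) (ε : ℝ) (T : ℕ) : Set (Fin 3) :=
  {j | ∃ (k : ℕ) (n : ℤ), k ≤ T ∧ |y + k * β - n| ≤ ε ∧ (upPerm ^ n * sheetPerm β y k) i = j}

theorem sheetsNear_mono {β y : ℝ} {i : Fin 3} {ε ε' : ℝ} {T T' : ℕ} (hε : ε ≤ ε') (hT : T ≤ T') :
    sheetsNear β y i ε T ⊆ sheetsNear β y i ε' T' :=
  fun _ ⟨k, n, hk, hn, hj⟩ => ⟨k, n, hk.trans hT, hn.trans hε, hj⟩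

/-- A path that starts close to a vertex runs parallel to the path from the vertex. -/
theorem sheetPerm_near {β c y : ℝ} (hβ : ∀ (q p : ℤ), 1 ≤ q → c / q ≤ |q * β - p|) (hc : 0 < c)
    {Q k : ℕ} {n : ℤ} (hk : k ≤ Q) (hn : |y - n| < c / Q) :
    upPerm ^ n * sheetPerm β y k = sheetPerm β 0 k * upPerm ^ n := by
  refine sheetPerm_shadow fun l hl hl' => Int.floor_eq_iff.2 ?_
  have hl0 : (0 : ℝ) < l := by exact_mod_cast hl
  have hlQ : (l : ℝ) ≤ Q := by exact_mod_cast hl'.trans hk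
  have hcl : c / Q ≤ c / l := div_le_div_of_nonneg_left hc.le hl0 hlQ
  rw [zero_add]
  have h1 := Int.floor_le (l * β)
  have h2 := Int.lt_floor_add_one (l * β)
  have h3 := hβ l ⌊l * β⌋ (by exact_mod_cast hl)
  have h4 := hβ l (⌊l * β⌋ + 1) (by exact_mod_cast hl)
  push_cast at h3 h4 ⊢
  rw [abs_of_nonneg (by linarith)] at h3
  rw [abs_of_neg (by linarith)] at h4
  obtain ⟨h5, h6⟩ := abs_lt.1 hn
  constructor <;> linarith

theorem closedPerm_mem_sheetsNear {β c y ε η : ℝ} {i j : Fin 3} {Q T q : ℕ} {p : ℤ}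
    (hβ : ∀ (q p : ℤ), 1 ≤ q → c / q ≤ |q * β - p|) (hc : 0 < c) (hε : ε < c / Q) (hq : q ≤ Q)
    (hη : |q * β - p| ≤ η) (hj : j ∈ sheetsNear β y i ε T) :
    closedPerm β q p j ∈ sheetsNear β y i (ε + η) (T + Q) := by
  obtain ⟨k, n, hk, hn, rfl⟩ := hj
  refine ⟨k + q, n + p, by omega, ?_, ?_⟩
  · have : y + (k + q : ℕ) * β - (n + p : ℤ) = (y + k * β - n) + (q * β - p) := by
      push_cast; ring
    rw [this]
    exact (abs_add_le _ _).trans (add_le_add hn hη)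
  · have := sheetPerm_near hβ hc hq (hn.trans_lt hε)
    rw [closedPerm, sheetPerm_add, add_comm n p, zpow_add, mul_assoc, ← mul_assoc (upPerm ^ n), this]
    rfl

open scoped Pointwise in
/-- Coarsening the scale and prolonging the time reveals a new sheet near the vertex, unless all
sheets are already there: a set of sheets that does not grow is invariant under the monodromy group. -/
theorem sheetsNear_eq_univ_or_ncard_lt {β c y ε : ℝ} {i : Fin 3} {Q T : ℕ} (hirr : Irrational β)
    (hβ : ∀ (q p : ℤ), 1 ≤ q → c / q ≤ |q * β - p|) (hc : 0 < c) (hQ : 1 ≤ Q) (hε : ε < c / Q)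
    (hne : (sheetsNear β y i ε T).Nonempty) :
    sheetsNear β y i (ε + 2 / (c * Q)) (T + Q) = Set.univ ∨
      (sheetsNear β y i ε T).ncard < (sheetsNear β y i (ε + 2 / (c * Q)) (T + Q)).ncard := by
  set B := sheetsNear β y i ε T with hB
  set B' := sheetsNear β y i (ε + 2 / (c * Q)) (T + Q) with hB'
  have hsub : B ⊆ B' := sheetsNear_mono (by linarith [show 0 < 2 / (c * Q) by positivity]) (by omega)
  rcases hsub.eq_or_ssubset with heq | hss
  · left
    obtain ⟨q₁, q₂, p₁, p₂, hF, h1, h2, h3, hgen⟩ := exists_fareyPair hirr Q hQ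
    have herr := hF.error_le hc hβ h1 h3
    have a1 : closedPerm β q₁ p₁ ∈ MulAction.stabilizer (Equiv.Perm (Fin 3)) B := by
      refine (MulAction.mem_stabilizer_set' B.toFinite).2 fun j hj => ?_
      rw [heq]
      exact closedPerm_mem_sheetsNear hβ hc hε h1 (by rw [abs_of_pos hF.left_pos]; exact herr.1) hj
    have a2 : closedPerm β q₂ p₂ ∈ MulAction.stabilizer (Equiv.Perm (Fin 3)) B := by
      refine (MulAction.mem_stabilizer_set' B.toFinite).2 fun j hj => ?_
      rw [heq]
      exact closedPerm_mem_sheetsNear hβ hc hε h2 (by rw [abs_of_neg hF.right_neg]; exact herr.2) hj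
    obtain ⟨hu, hr⟩ := hgen _ a1 a2
    rw [← heq]
    exact eq_univ_of_upPerm_rightPerm hne hu hr
  · exact Or.inr (Set.ncard_lt_ncard hss B'.toFinite)

/-- A lattice point comes within `4 / (c Q)` of any line of slope `β`, in at most `2 Q` steps. -/
theorem exists_abs_add_mul_sub_le {β c : ℝ} (hirr : Irrational β)
    (hβ : ∀ (q p : ℤ), 1 ≤ q → c / q ≤ |q * β - p|) (hc : 0 < c) {Q : ℕ} (hQ : 1 ≤ Q) (y : ℝ) :
    ∃ (k : ℕ) (n : ℤ), k ≤ 2 * Q ∧ |y + k * β - n| ≤ 4 / (c * Q) := by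
  obtain ⟨q₁, q₂, p₁, p₂, hF, h1, h2, h3, -⟩ := exists_fareyPair hirr Q hQ
  have herr := hF.error_le hc hβ h1 h3
  obtain ⟨k, n, hk, hn⟩ := hF.exists_near y
  refine ⟨k, n, by omega, hn.trans ?_⟩
  have : 4 / (c * Q) = 2 / (c * Q) + 2 / (c * Q) := by ring
  linarith [herr.1, herr.2]

/-- Every path visits all three sheets near the vertex, in a time inversely proportional to the
distance. -/
theorem exists_sheetsNear_eq_univ {β c : ℝ} (hirr : Irrational β)
    (hβ : ∀ (q p : ℤ), 1 ≤ q → c / q ≤ |q * β - p|) (hc : 0 < c) :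
    ∃ M : ℕ, 1 ≤ M ∧ ∀ (Q : ℕ), 1 ≤ Q → ∀ (y : ℝ) (i : Fin 3) (ε : ℝ), c / (2 * Q) ≤ ε →
      sheetsNear β y i ε (M * Q) = Set.univ := by
  -- the ratio `M` of consecutive scales is such that the errors at one scale are small compared to
  -- the distance up to which paths run parallel at the next coarser one
  obtain ⟨M, hM⟩ := exists_nat_gt (16 / c ^ 2 + 4)
  have hM16 : 16 < M * c ^ 2 := by
    have : 16 / c ^ 2 < M := by linarith
    rwa [div_lt_iff₀ (by positivity)] at this
  have hM4 : (4 : ℝ) < M := by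
    have : 0 < 16 / c ^ 2 := by positivity
    linarith
  have hM1' : 1 ≤ M := by exact_mod_cast (by linarith : (1 : ℝ) ≤ M)
  refine ⟨M * (2 * M ^ 2 + M + 1), Nat.mul_pos hM1' (by positivity), fun Q hQ y i ε hε => ?_⟩
  have hQ' : (0 : ℝ) < Q := by exact_mod_cast hQ
  set q₀ := M * Q with hq₀
  have hq₀1 : 1 ≤ q₀ := Nat.mul_pos hM1' hQ
  have hq₀' : (0 : ℝ) < q₀ := by exact_mod_cast hq₀1
  have c1 : 4 / (c * (M * (M * q₀) : ℕ)) < c / (M * q₀ : ℕ) := by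
    push_cast
    rw [div_lt_div_iff₀ (by positivity) (by positivity)]
    have : 0 < M * (q₀ : ℝ) := by positivity
    nlinarith
  have c2 : 4 / (c * (M * (M * q₀) : ℕ)) + 2 / (c * (M * q₀ : ℕ)) < c / q₀ := by
    have h1 : 4 / (c * (M * (M * q₀) : ℕ)) ≤ 4 / (c * (M * q₀ : ℕ)) := by
      have : (M * q₀ : ℕ) ≤ M * (M * q₀) := Nat.le_mul_of_pos_left _ hM1'
      have : ((M * q₀ : ℕ) : ℝ) ≤ (M * (M * q₀) : ℕ) := by exact_mod_cast this
      have h0 : (0 : ℝ) < (M * q₀ : ℕ) := by push_cast; positivity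
      gcongr
    have h2 : 6 / (c * (M * q₀ : ℕ)) < c / q₀ := by
      push_cast
      rw [div_lt_div_iff₀ (by positivity) hq₀']
      nlinarith
    have h3 : 6 / (c * (M * q₀ : ℕ)) = 4 / (c * (M * q₀ : ℕ)) + 2 / (c * (M * q₀ : ℕ)) := by ring
    linarith
  have c3 : 4 / (c * (M * (M * q₀) : ℕ)) + 2 / (c * (M * q₀ : ℕ)) + 2 / (c * q₀) ≤ ε := by
    refine le_trans ?_ hε
    have h1 : 2 / (c * q₀) ≤ c / (4 * Q) := by
      rw [hq₀]
      push_cast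
      rw [div_le_div_iff₀ (by positivity) (by positivity)]
      nlinarith
    have h2 : c / q₀ ≤ c / (4 * Q) := by
      rw [hq₀]
      push_cast
      gcongr
    have h3 : c / (2 * Q) = c / (4 * Q) + c / (4 * Q) := by ring
    linarith
  obtain ⟨k, n, hk, hn⟩ := exists_abs_add_mul_sub_le hirr hβ hc
    (Nat.mul_pos hM1' (Nat.mul_pos hM1' hq₀1)) y
  have hne : (sheetsNear β y i (4 / (c * (M * (M * q₀) : ℕ))) (2 * (M * (M * q₀)))).Nonempty :=
    ⟨_, k, n, hk, hn, rfl⟩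
  have hsub := sheetsNear_mono (β := β) (y := y) (i := i) c3
    (show 2 * (M * (M * q₀)) + M * q₀ + q₀ ≤ M * (2 * M ^ 2 + M + 1) * Q by
      rw [hq₀]; exact le_of_eq (by ring))
  have hne' := hne.mono (sheetsNear_mono (show _ ≤ 4 / (c * (M * (M * q₀) : ℕ)) +
    2 / (c * (M * q₀ : ℕ)) from le_add_of_nonneg_right (by positivity)) (Nat.le_add_right _ (M * q₀)))
  have g1 := sheetsNear_eq_univ_or_ncard_lt hirr hβ hc (Nat.mul_pos hM1' hq₀1) c1 hne
  have g2 := sheetsNear_eq_univ_or_ncard_lt hirr hβ hc hq₀1 c2 hne'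
  refine Set.eq_univ_of_univ_subset (Set.Subset.trans ?_ hsub)
  rcases g2 with g2 | g2
  · exact g2.ge
  · have h3 : ∀ B : Set (Fin 3), B.ncard ≤ 3 := fun B => by
      simpa using Set.ncard_le_card B
    have h1 : 0 < _ := (Set.ncard_pos (Set.toFinite _)).2 hne
    refine (Set.eq_of_subset_of_ncard_le (Set.subset_univ _) ?_).ge
    rw [Set.ncard_univ, Nat.card_eq_fintype_card, Fintype.card_fin]
    rcases g1 with g1 | g1
    · rw [g1, Set.ncard_univ, Nat.card_eq_fintype_card, Fintype.card_fin] at g2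
      exact g2.le
    · omega

/-- Superdensity of the skew product of a rotation by a badly approximable number. -/
theorem exists_sheetPerm_eq_and_abs_le {β c : ℝ} (hirr : Irrational β)
    (hβ : ∀ (q p : ℤ), 1 ≤ q → c / q ≤ |q * β - p|) (hc : 0 < c) :
    ∃ M : ℕ, ∀ (N : ℕ), 1 ≤ N → ∀ (y w : ℝ) (i j : Fin 3), ∃ (k : ℕ) (n : ℤ), k ≤ M * N ∧
      |y + k * β - n - w| ≤ 1 / N ∧ (upPerm ^ n * sheetPerm β y k) i = j := by
  obtain ⟨M, -, hM⟩ := exists_sheetsNear_eq_univ hirr hβ hc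
  obtain ⟨K, hK⟩ := exists_nat_gt (c / 4 + 4 / c)
  have hK0 : (0 : ℝ) < K := lt_trans (by positivity) hK
  have hK1 : 1 ≤ K := by exact_mod_cast hK0
  refine ⟨(2 * M + 2) * K, fun N hN y w i j => ?_⟩
  have hN' : (0 : ℝ) < N := by exact_mod_cast hN
  have hQ : 1 ≤ K * N := Nat.mul_pos hK1 hN
  -- from the target backwards to a vertex
  obtain ⟨k, n, hk, hn⟩ := exists_abs_add_mul_sub_le hirr hβ hc hQ (-w)
  have huniv := hM (2 * (K * N)) (by omega) y i _ le_rfl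
  -- the sheet near the vertex that leads to the target
  obtain ⟨t, m, ht, hm, hj⟩ : (upPerm ^ n * sheetPerm β 0 k)⁻¹ j ∈ sheetsNear β y i _ _ :=
    huniv ▸ Set.mem_univ _
  refine ⟨t + k, m + n, ?_, ?_, ?_⟩
  · calc t + k ≤ M * (2 * (K * N)) + 2 * (K * N) := add_le_add ht hk
      _ = (2 * M + 2) * K * N := by ring
  · have e : y + (t + k : ℕ) * β - (m + n : ℤ) - w = (y + t * β - m) + (-w + k * β - n) := by
      push_cast; ring
    rw [e]
    refine (abs_add_le _ _).trans ((add_le_add hm hn).trans ?_)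
    have e2 : c / (2 * ((2 * (K * N) : ℕ) : ℝ)) + 4 / (c * ((K * N : ℕ) : ℝ)) =
        (c / 4 + 4 / c) / K * (1 / N) := by
      push_cast; field_simp; ring
    rw [e2]
    refine mul_le_of_le_one_left (by positivity) ?_
    rw [div_le_one hK0]
    exact hK.le
  · have hpar := sheetPerm_near (y := y + t * β) (n := m) hβ hc hk (hm.trans_lt (by
      have : (0 : ℝ) < (2 * (K * N) : ℕ) := by push_cast; positivity
      exact div_lt_div_of_pos_left hc this (by linarith)))
    have e : upPerm ^ (m + n) * sheetPerm β y (t + k) =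
        (upPerm ^ n * sheetPerm β 0 k) * (upPerm ^ m * sheetPerm β y t) := by
      rw [sheetPerm_add, add_comm m n, zpow_add, mul_assoc, ← mul_assoc (upPerm ^ m), hpar]
      simp only [mul_assoc]
    rw [e, Equiv.Perm.mul_apply, hj]
    simp

/-! ### Points of the L-surface in square coordinates -/

/-- The abscissa of the lower left corner of a square. -/
def cornerX : Fin 3 → ℝ := ![0, 1, 0]

/-- The ordinate of the lower left corner of a square. -/
def cornerY : Fin 3 → ℝ := ![0, 0, 1]

/-- The point of the plane with coordinates `(x, y)` relative to the lower left corner of the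
square `i`. -/
def squarePoint (i : Fin 3) (x y : ℝ) : Plane := !₂[cornerX i + x, cornerY i + y]

@[simp]
theorem squarePoint_zero (i : Fin 3) (x y : ℝ) : squarePoint i x y 0 = cornerX i + x := rfl

@[simp]
theorem squarePoint_one (i : Fin 3) (x y : ℝ) : squarePoint i x y 1 = cornerY i + y := rfl

theorem plane_ext {p q : Plane} (h0 : p 0 = q 0) (h1 : p 1 = q 1) : p = q := by
  ext i
  fin_cases i
  · exact h0
  · exact h1

theorem mem_LShape_iff {p : Plane} :
    p ∈ LShape ↔ ∃ i : Fin 3, p ∈ unitSquare (cornerX i) (cornerY i) := by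
  simp [LShape, Fin.exists_fin_succ, cornerX, cornerY, or_assoc]

theorem squarePoint_mem_unitSquare (i : Fin 3) {x y : ℝ} (hx : x ∈ Set.Icc (0 : ℝ) 1)
    (hy : y ∈ Set.Icc (0 : ℝ) 1) : squarePoint i x y ∈ unitSquare (cornerX i) (cornerY i) := by
  obtain ⟨x0, x1⟩ := hx
  obtain ⟨y0, y1⟩ := hy
  refine ⟨⟨?_, ?_⟩, ?_, ?_⟩ <;> simp <;> linarith

theorem squarePoint_mem (i : Fin 3) {x y : ℝ} (hx : x ∈ Set.Icc (0 : ℝ) 1)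
    (hy : y ∈ Set.Icc (0 : ℝ) 1) : squarePoint i x y ∈ LShape :=
  mem_LShape_iff.2 ⟨i, squarePoint_mem_unitSquare i hx hy⟩

/-- The point of the L-surface with coordinates `(x, y)` in the square `i`. The coordinates are
first projected to `[0, 1]`, so that the function is total. -/
noncomputable def squareMk (i : Fin 3) (x y : ℝ) : LSurface :=
  LSurface.mk ⟨squarePoint i (Set.projIcc 0 1 zero_le_one x) (Set.projIcc 0 1 zero_le_one y),
    squarePoint_mem i (Subtype.prop _) (Subtype.prop _)⟩

theorem squareMk_eq (i : Fin 3) {x y : ℝ} (hx : x ∈ Set.Icc (0 : ℝ) 1)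
    (hy : y ∈ Set.Icc (0 : ℝ) 1) :
    squareMk i x y = LSurface.mk ⟨squarePoint i x y, squarePoint_mem i hx hy⟩ := by
  simp only [squareMk, Set.projIcc_of_mem zero_le_one hx, Set.projIcc_of_mem zero_le_one hy]

theorem mk_eq_squareMk {i : Fin 3} {p : Plane} (hp : p ∈ LShape)
    (h : p ∈ unitSquare (cornerX i) (cornerY i)) :
    LSurface.mk ⟨p, hp⟩ = squareMk i (p 0 - cornerX i) (p 1 - cornerY i) := by
  obtain ⟨⟨h1, h2⟩, h3, h4⟩ := h
  rw [squareMk_eq i ⟨by linarith, by linarith⟩ ⟨by linarith, by linarith⟩]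
  congr 2
  exact plane_ext (by simp) (by simp)

theorem squareMk_right (i : Fin 3) (y : ℝ) : squareMk i 1 y = squareMk (rightPerm i) 0 y := by
  obtain ⟨z0, z1⟩ := (Set.projIcc (0 : ℝ) 1 zero_le_one y).2
  fin_cases i
  · exact congrArg LSurface.mk (Subtype.ext (plane_ext
      (by simp [rightPerm, cornerX]) (by simp [rightPerm, cornerY])))
  · refine (Quot.sound (EdgeGlue.v1 _ _ ?_ ?_ ?_ ?_)).symm
    all_goals simp [rightPerm, cornerX, cornerY]
    norm_num
  · refine (Quot.sound (EdgeGlue.v2 _ _ ?_ ?_ ?_ ?_)).symm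
    all_goals simp [rightPerm, cornerX, cornerY, Equiv.swap_apply_of_ne_of_ne]
    · exact ⟨by linarith, by linarith⟩

theorem squareMk_up (i : Fin 3) (x : ℝ) : squareMk i x 1 = squareMk (upPerm i) x 0 := by
  obtain ⟨z0, z1⟩ := (Set.projIcc (0 : ℝ) 1 zero_le_one x).2
  fin_cases i
  · exact congrArg LSurface.mk (Subtype.ext (plane_ext
      (by simp [upPerm, cornerX]) (by simp [upPerm, cornerY])))
  · refine (Quot.sound (EdgeGlue.h2 _ _ ?_ ?_ ?_ ?_)).symm
    all_goals simp [upPerm, cornerX, cornerY, Equiv.swap_apply_of_ne_of_ne]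
    · exact ⟨by linarith, by linarith⟩
  · refine (Quot.sound (EdgeGlue.h1 _ _ ?_ ?_ ?_ ?_)).symm
    all_goals simp [upPerm, cornerX, cornerY]
    norm_num

theorem isVertex_squareMk (i : Fin 3) {x y : ℝ} (hx : x = 0 ∨ x = 1) (hy : y = 0 ∨ y = 1) :
    IsVertex (squareMk i x y) := by
  have hx' : x ∈ Set.Icc (0 : ℝ) 1 := by rcases hx with rfl | rfl <;> simp
  have hy' : y ∈ Set.Icc (0 : ℝ) 1 := by rcases hy with rfl | rfl <;> simp
  refine ⟨_, (squareMk_eq i hx' hy').symm, ![0, 1, 0] i + ⌊x⌋, ![0, 0, 1] i + ⌊y⌋, ?_, ?_⟩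
  · rcases hx with rfl | rfl <;> fin_cases i <;> norm_num [cornerX]
  · rcases hy with rfl | rfl <;> fin_cases i <;> norm_num [cornerY]

open Classical in
/-- The square that contains the point `(x, y)` of the L-shape, other than a vertex. Of the squares
that share a vertical edge the one on the right is chosen, and of the squares that share a
horizontal edge the upper one. -/
noncomputable def squareIndex (x y : ℝ) : Fin 3 :=
  if Int.fract x = 0 ∧ Int.fract y = 0 then 0
  else if 1 < x ∧ x < 2 then 1
  else if 1 < y ∧ y < 2 then 2
  else if x = 1 then 1
  else if y = 1 then 2
  else 0

theorem edgeGlue_invariant {p q : LShape} (h : EdgeGlue p q) :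
    Int.fract (p.1 0) = Int.fract (q.1 0) ∧ Int.fract (p.1 1) = Int.fract (q.1 1) ∧
      squareIndex (p.1 0) (p.1 1) = squareIndex (q.1 0) (q.1 1) := by
  have f1 : Int.fract (1 : ℝ) = 0 := Int.fract_one
  have f2 : Int.fract (2 : ℝ) = 0 := Int.fract_ofNat 2
  have f0 : Int.fract (0 : ℝ) = 0 := Int.fract_zero
  have k1 : ∀ x : ℝ, 0 ≤ x → x ≤ 1 → squareIndex x 0 = squareIndex x 2 := by
    intro x h0 h1
    simp only [squareIndex, f0, f2]
    split_ifs <;> first | rfl | (exfalso; grind)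
  have k2 : ∀ x : ℝ, 1 ≤ x → x ≤ 2 → squareIndex x 0 = squareIndex x 1 := by
    intro x h0 h1
    simp only [squareIndex, f0, f1]
    split_ifs <;> first | rfl | (exfalso; grind)
  have k3 : ∀ y : ℝ, 0 ≤ y → y ≤ 1 → squareIndex 0 y = squareIndex 2 y := by
    intro y h0 h1
    simp only [squareIndex, f0, f2]
    split_ifs <;> first | rfl | (exfalso; grind)
  have k4 : ∀ y : ℝ, 1 ≤ y → y ≤ 2 → squareIndex 0 y = squareIndex 1 y := by
    intro y h0 h1
    simp only [squareIndex, f0, f1]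
    split_ifs <;> first | rfl | (exfalso; grind)
  cases h with
  | h1 hp hp' hq hq' =>
    exact ⟨by rw [hq], by rw [hp', hq', f0, f2], by rw [hp', hq, hq', k1 _ hp.1 hp.2]⟩
  | h2 hp hp' hq hq' =>
    exact ⟨by rw [hq], by rw [hp', hq', f0, f1], by rw [hp', hq, hq', k2 _ hp.1 hp.2]⟩
  | v1 hp hp' hq hq' =>
    exact ⟨by rw [hp', hq', f0, f2], by rw [hq], by rw [hp', hq, hq', k3 _ hp.1 hp.2]⟩
  | v2 hp hp' hq hq' =>
    exact ⟨by rw [hp', hq', f0, f1], by rw [hq], by rw [hp', hq, hq', k4 _ hp.1 hp.2]⟩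

/-- The coordinates modulo `1` and the square of a point of the L-surface. -/
noncomputable def coords : LSurface → ℝ × ℝ × Fin 3 :=
  Quot.lift (fun p => (Int.fract (p.1 0), Int.fract (p.1 1), squareIndex (p.1 0) (p.1 1))) fun p q h => by
    obtain ⟨h0, h1, h2⟩ := edgeGlue_invariant h
    simp only [h0, h1, h2]

theorem fract_cornerX_add (i : Fin 3) (x : ℝ) : Int.fract (cornerX i + x) = Int.fract x := by
  fin_cases i <;> simp [cornerX]

theorem fract_cornerY_add (i : Fin 3) (y : ℝ) : Int.fract (cornerY i + y) = Int.fract y := by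
  fin_cases i <;> simp [cornerY]

theorem squareIndex_squarePoint (i : Fin 3) {x y : ℝ} (hx : x ∈ Set.Ico (0 : ℝ) 1)
    (hy : y ∈ Set.Ico (0 : ℝ) 1) (hxy : ¬ (x = 0 ∧ y = 0)) :
    squareIndex (cornerX i + x) (cornerY i + y) = i := by
  have fx : Int.fract x = x := Int.fract_eq_self.2 hx
  have fy : Int.fract y = y := Int.fract_eq_self.2 hy
  obtain ⟨x0, x1⟩ := hx
  obtain ⟨y0, y1⟩ := hy
  unfold squareIndex
  rw [fract_cornerX_add, fract_cornerY_add, fx, fy, if_neg hxy]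
  fin_cases i <;> simp only [cornerX, cornerY] <;> split_ifs <;>
    simp at * <;> grind

theorem coords_squareMk (i : Fin 3) {x y : ℝ} (hx : x ∈ Set.Icc (0 : ℝ) 1)
    (hy : y ∈ Set.Icc (0 : ℝ) 1) : coords (squareMk i x y) =
      (Int.fract x, Int.fract y, squareIndex (cornerX i + x) (cornerY i + y)) := by
  rw [squareMk_eq i hx hy]
  change (Int.fract (cornerX i + x), Int.fract (cornerY i + y), _) = _
  rw [fract_cornerX_add, fract_cornerY_add]
  rfl

theorem eq_of_fract_eq {x x' : ℝ} (hx : x ∈ Set.Icc (0 : ℝ) 1) (hx' : x' ∈ Set.Icc (0 : ℝ) 1)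
    (h : Int.fract x = Int.fract x') (h1 : ¬ (x = 0 ∧ x' = 1)) (h2 : ¬ (x = 1 ∧ x' = 0)) :
    x = x' := by
  rcases hx.2.lt_or_eq with hx1 | rfl <;> rcases hx'.2.lt_or_eq with hx1' | rfl
  · rwa [Int.fract_eq_self.2 ⟨hx.1, hx1⟩, Int.fract_eq_self.2 ⟨hx'.1, hx1'⟩] at h
  · rw [Int.fract_eq_self.2 ⟨hx.1, hx1⟩, Int.fract_one] at h
    exact absurd ⟨h, rfl⟩ h1
  · rw [Int.fract_eq_self.2 ⟨hx'.1, hx1'⟩, Int.fract_one] at h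
    exact absurd ⟨rfl, h.symm⟩ h2
  · rfl

theorem index_eq_of_squareMk_eq {i i' : Fin 3} {x y : ℝ} (hx : x ∈ Set.Ico (0 : ℝ) 1)
    (hy : y ∈ Set.Ico (0 : ℝ) 1) (hv : ¬ IsVertex (squareMk i x y))
    (h : squareMk i x y = squareMk i' x y) : i = i' := by
  have hxy : ¬ (x = 0 ∧ y = 0) := fun h0 => hv (isVertex_squareMk i (Or.inl h0.1) (Or.inl h0.2))
  have := congrArg coords h
  rw [coords_squareMk i ⟨hx.1, hx.2.le⟩ ⟨hy.1, hy.2.le⟩,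
    coords_squareMk i' ⟨hx.1, hx.2.le⟩ ⟨hy.1, hy.2.le⟩, squareIndex_squarePoint i hx hy hxy,
    squareIndex_squarePoint i' hx hy hxy] at this
  simpa using this

/-- Square coordinates of a point other than a vertex are unique, up to passing from an edge of a
square to the opposite edge of a neighbour. -/
theorem squareMk_inj {i i' : Fin 3} {x x' y y' : ℝ} (hx : x ∈ Set.Icc (0 : ℝ) 1)
    (hx' : x' ∈ Set.Icc (0 : ℝ) 1) (hy : y ∈ Set.Icc (0 : ℝ) 1) (hy' : y' ∈ Set.Icc (0 : ℝ) 1)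
    (hx1 : ¬ (x = 0 ∧ x' = 1)) (hx2 : ¬ (x = 1 ∧ x' = 0)) (hy1 : ¬ (y = 0 ∧ y' = 1))
    (hy2 : ¬ (y = 1 ∧ y' = 0)) (hv : ¬ IsVertex (squareMk i x y))
    (h : squareMk i x y = squareMk i' x' y') : i = i' ∧ x = x' ∧ y = y' := by
  have hc := congrArg coords h
  rw [coords_squareMk i hx hy, coords_squareMk i' hx' hy', Prod.mk.injEq, Prod.mk.injEq] at hc
  obtain rfl := eq_of_fract_eq hx hx' hc.1 hx1 hx2
  obtain rfl := eq_of_fract_eq hy hy' hc.2.1 hy1 hy2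
  refine ⟨?_, rfl, rfl⟩
  have h01 : (0 : ℝ) ∈ Set.Ico (0 : ℝ) 1 := by simp
  rcases hx.2.lt_or_eq with hx1 | rfl <;> rcases hy.2.lt_or_eq with hy1 | rfl
  · exact index_eq_of_squareMk_eq ⟨hx.1, hx1⟩ ⟨hy.1, hy1⟩ hv h
  · rw [squareMk_up] at hv
    rw [squareMk_up, squareMk_up] at h
    exact upPerm.injective (index_eq_of_squareMk_eq ⟨hx.1, hx1⟩ h01 hv h)
  · rw [squareMk_right] at hv
    rw [squareMk_right, squareMk_right] at h
    exact rightPerm.injective (index_eq_of_squareMk_eq h01 ⟨hy.1, hy1⟩ hv h)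
  · exact absurd (isVertex_squareMk i (Or.inr rfl) (Or.inr rfl)) hv

/-! ### Points of the L-surface in column coordinates -/

/-- The point at height `y` and abscissa `x` on a column of unit width, on the sheet that the
square `i` occupies at the heights in `[0, 1]`. -/
noncomputable def columnMk (i : Fin 3) (x y : ℝ) : LSurface :=
  squareMk ((upPerm ^ ⌊y⌋) i) x (Int.fract y)

theorem columnMk_eq (i : Fin 3) (x : ℝ) {y : ℝ} {n : ℤ} (h : y - n ∈ Set.Icc (0 : ℝ) 1) :
    columnMk i x y = squareMk ((upPerm ^ n) i) x (y - n) := by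
  rcases h.2.lt_or_eq with h1 | h1
  · have hf : ⌊y⌋ = n := Int.floor_eq_iff.2 ⟨by linarith [h.1], by linarith⟩
    rw [columnMk, ← Int.self_sub_floor, hf]
  · have hy : y = ((n + 1 : ℤ) : ℝ) := by push_cast; linarith
    rw [h1, squareMk_up, columnMk, hy, Int.floor_intCast, Int.fract_intCast, add_comm, zpow_add,
      zpow_one]
    rfl

theorem columnMk_add_int (i : Fin 3) (x y : ℝ) (n : ℤ) :
    columnMk i x y = columnMk ((upPerm ^ n) i) x (y - n) := by
  rw [columnMk, columnMk, Int.floor_sub_intCast, Int.fract_sub_intCast, ← Equiv.Perm.mul_apply,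
    ← zpow_add, sub_add_cancel]

theorem upPerm_zpow_crossPerm (n : ℤ) (i : Fin 3) :
    (upPerm ^ n) (crossPerm n i) = rightPerm ((upPerm ^ n) i) := by
  rw [← Equiv.Perm.mul_apply, ← Equiv.Perm.mul_apply, crossPerm]
  congr 1
  group

theorem columnMk_right (i : Fin 3) (y : ℝ) :
    columnMk i 1 y = columnMk (crossPerm ⌊y⌋ i) 0 y := by
  rw [columnMk, columnMk, squareMk_right, upPerm_zpow_crossPerm]

theorem crossPerm_crossPerm (n : ℤ) (i : Fin 3) : crossPerm n (crossPerm n i) = i := by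
  apply (upPerm ^ n).injective
  rw [upPerm_zpow_crossPerm, upPerm_zpow_crossPerm, rightPerm, Equiv.swap_apply_self]

theorem columnMk_left (i : Fin 3) (y : ℝ) :
    columnMk i 0 y = columnMk (crossPerm ⌊y⌋ i) 1 y := by
  rw [columnMk_right, crossPerm_crossPerm]

/-! ### Geodesics in square and column coordinates -/

theorem add_mul_mem_Icc {a b x w s r : ℝ} (hx : x ∈ Set.Icc a b) (hs : x + s * w ∈ Set.Icc a b)
    (hr : r ∈ Set.Icc 0 s) : x + r * w ∈ Set.Icc a b := by
  obtain ⟨r0, r1⟩ := hr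
  obtain ⟨x0, x1⟩ := hx
  obtain ⟨s0, s1⟩ := hs
  rcases le_total 0 w with hw | hw
  · have h1 := mul_le_mul_of_nonneg_right r1 hw
    have h2 := mul_nonneg r0 hw
    constructor <;> linarith
  · have h1 := mul_le_mul_of_nonpos_right r1 hw
    have h2 := mul_nonpos_of_nonneg_of_nonpos r0 hw
    constructor <;> linarith

theorem isClosed_unitSquare (a b : ℝ) : IsClosed (unitSquare a b) := by
  have h0 : Continuous fun p : Plane => p 0 := by fun_prop
  have h1 : Continuous fun p : Plane => p 1 := by fun_prop
  exact (isClosed_Icc.preimage h0).inter (isClosed_Icc.preimage h1)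

/-- An initial piece of a segment in the L-shape lies in one of the squares. -/
theorem exists_unitSquare_of_segment {p w : Plane} {ε : ℝ} (hε : 0 < ε)
    (h : ∀ s ∈ Set.Icc (0 : ℝ) ε, p + s • w ∈ LShape) :
    ∃ (i : Fin 3) (δ : ℝ), 0 < δ ∧ δ ≤ ε ∧
      ∀ s ∈ Set.Icc (0 : ℝ) δ, p + s • w ∈ unitSquare (cornerX i) (cornerY i) := by
  have hev : ∀ᶠ s in nhdsWithin (0 : ℝ) (Set.Ioi 0), s ∈ Set.Ioc 0 ε := Ioc_mem_nhdsGT hε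
  obtain ⟨i, hi⟩ : ∃ i : Fin 3, ∃ᶠ s in nhdsWithin (0 : ℝ) (Set.Ioi 0),
      p + s • w ∈ unitSquare (cornerX i) (cornerY i) := by
    by_contra! hcon
    obtain ⟨s, hs, hs'⟩ := (hev.and (Filter.eventually_all.2 hcon)).exists
    obtain ⟨i, hi⟩ := mem_LShape_iff.1 (h s ⟨hs.1.le, hs.2⟩)
    exact hs' i hi
  have htend : Filter.Tendsto (fun s : ℝ => p + s • w) (nhdsWithin 0 (Set.Ioi 0)) (nhds p) := by
    have : Continuous fun s : ℝ => p + s • w := by fun_prop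
    simpa using (this.tendsto 0).mono_left nhdsWithin_le_nhds
  have hp := (isClosed_unitSquare _ _).mem_of_frequently_of_tendsto hi htend
  obtain ⟨s, hs, hs'⟩ := (hi.and_eventually hev).exists
  refine ⟨i, s, hs'.1, hs'.2, fun r hr => ⟨?_, ?_⟩⟩
  · exact add_mul_mem_Icc (w := w 0) hp.1 hs.1 hr
  · exact add_mul_mem_Icc (w := w 1) hp.2 hs.2 hr

theorem IsGeodesic.forward_square {γ : ℝ → LSurface} {v : Plane} (hγ : IsGeodesic γ v) {t : ℝ}
    (ht : 0 ≤ t) : ∃ (ε : ℝ) (i : Fin 3) (x y : ℝ), 0 < ε ∧ ∀ s ∈ Set.Icc (0 : ℝ) ε,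
      x + s * v 0 ∈ Set.Icc (0 : ℝ) 1 ∧ y + s * v 1 ∈ Set.Icc (0 : ℝ) 1 ∧
        γ (t + s) = squareMk i (x + s * v 0) (y + s * v 1) := by
  obtain ⟨ε, hε, p, hp⟩ := hγ.forward t ht
  obtain ⟨i, δ, hδ, hδε, hi⟩ := exists_unitSquare_of_segment hε fun s hs => (hp s hs).1
  refine ⟨δ, i, p 0 - cornerX i, p 1 - cornerY i, hδ, fun s hs => ?_⟩
  have hs' := hi s hs
  obtain ⟨hL, hγs⟩ := hp s ⟨hs.1, hs.2.trans hδε⟩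
  have e0 : p 0 - cornerX i + s * v 0 = (p + s • v) 0 - cornerX i := by simp; ring
  have e1 : p 1 - cornerY i + s * v 1 = (p + s • v) 1 - cornerY i := by simp; ring
  obtain ⟨⟨h1, h2⟩, h3, h4⟩ := id hs'
  rw [e0, e1, hγs, mk_eq_squareMk hL hs']
  exact ⟨⟨by linarith, by linarith⟩, ⟨by linarith, by linarith⟩, rfl⟩

theorem IsGeodesic.backward_square {γ : ℝ → LSurface} {v : Plane} (hγ : IsGeodesic γ v) {t : ℝ}
    (ht : 0 < t) : ∃ (ε : ℝ) (i : Fin 3) (x y : ℝ), 0 < ε ∧ ε ≤ t ∧ ∀ s ∈ Set.Icc (0 : ℝ) ε,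
      x - s * v 0 ∈ Set.Icc (0 : ℝ) 1 ∧ y - s * v 1 ∈ Set.Icc (0 : ℝ) 1 ∧
        γ (t - s) = squareMk i (x - s * v 0) (y - s * v 1) := by
  obtain ⟨ε, hε, hεt, p, hp⟩ := hγ.backward t ht
  obtain ⟨i, δ, hδ, hδε, hi⟩ := exists_unitSquare_of_segment (w := -v) hε fun s hs => by
    rw [smul_neg, ← sub_eq_add_neg]
    exact (hp s hs).1
  refine ⟨δ, i, p 0 - cornerX i, p 1 - cornerY i, hδ, hδε.trans hεt, fun s hs => ?_⟩
  have hs' := hi s hs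
  rw [smul_neg, ← sub_eq_add_neg] at hs'
  obtain ⟨hL, hγs⟩ := hp s ⟨hs.1, hs.2.trans hδε⟩
  have e0 : p 0 - cornerX i - s * v 0 = (p - s • v) 0 - cornerX i := by simp; ring
  have e1 : p 1 - cornerY i - s * v 1 = (p - s • v) 1 - cornerY i := by simp; ring
  obtain ⟨⟨h1, h2⟩, h3, h4⟩ := id hs'
  rw [e0, e1, hγs, mk_eq_squareMk hL hs']
  exact ⟨⟨by linarith, by linarith⟩, ⟨by linarith, by linarith⟩, rfl⟩

/-- An initial piece of a motion on the real line stays between two consecutive integers. -/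
theorem exists_int_add_mul_mem (Y w : ℝ) :
    ∃ (n : ℤ) (ε : ℝ), 0 < ε ∧ ∀ h ∈ Set.Icc 0 ε, Y + h * w - n ∈ Set.Icc (0 : ℝ) 1 := by
  have key : ∀ Y w : ℝ, 0 ≤ w →
      ∃ (n : ℤ) (ε : ℝ), 0 < ε ∧ ∀ h ∈ Set.Icc 0 ε, Y + h * w - n ∈ Set.Icc (0 : ℝ) 1 := by
    intro Y w hw
    have h1 := Int.floor_le Y
    have h2 := Int.lt_floor_add_one Y
    refine ⟨⌊Y⌋, (⌊Y⌋ + 1 - Y) / (w + 1), div_pos (by linarith) (by linarith), fun h hh => ?_⟩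
    have h3 := (le_div_iff₀ (by linarith)).1 hh.2
    have h4 := mul_nonneg hh.1 hw
    have h5 := hh.1
    constructor <;> linarith
  rcases le_total 0 w with hw | hw
  · exact key Y w hw
  · obtain ⟨n, ε, hε, h⟩ := key (-Y) (-w) (by linarith)
    refine ⟨-n - 1, ε, hε, fun r hr => ?_⟩
    obtain ⟨h1, h2⟩ := h r hr
    push_cast
    constructor <;> linarith

/-- Induction along a real interval. -/
theorem forall_mem_Icc_of_step {P : ℝ → Prop} {τ : ℝ} (h0 : P 0)
    (hl : ∀ s, 0 < s → s ≤ τ → (∀ r, 0 ≤ r → r < s → P r) → P s)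
    (hr : ∀ s, 0 ≤ s → s < τ → P s → ∃ ε, 0 < ε ∧ ∀ r, s ≤ r → r ≤ s + ε → r ≤ τ → P r) :
    ∀ s ∈ Set.Icc 0 τ, P s := by
  intro s₁ hs₁
  by_contra hcon
  -- the infimum of the bad points is good, and so are the points right after it
  set B := {s : ℝ | 0 ≤ s ∧ s ≤ τ ∧ ¬ P s} with hB
  have hne : B.Nonempty := ⟨s₁, hs₁.1, hs₁.2, hcon⟩
  have hbdd : BddBelow B := ⟨0, fun s hs => hs.1⟩
  set m := sInf B with hm
  have hm0 : 0 ≤ m := le_csInf hne fun s hs => hs.1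
  have hmτ : m ≤ τ := (csInf_le hbdd ⟨hs₁.1, hs₁.2, hcon⟩).trans hs₁.2
  have hlt : ∀ r, 0 ≤ r → r < m → P r := fun r hr0 hrm => by
    by_contra hbad
    exact absurd (csInf_le hbdd (show r ∈ B from ⟨hr0, hrm.le.trans hmτ, hbad⟩)) (not_le.2 hrm)
  have hPm : P m := by
    rcases hm0.eq_or_lt with h | h
    · rwa [← h]
    · exact hl m h hmτ hlt
  have hmlt : m < τ := by
    refine lt_of_le_of_ne hmτ fun heq => ?_
    have h1 := csInf_le hbdd (show s₁ ∈ B from ⟨hs₁.1, hs₁.2, hcon⟩)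
    have h2 : s₁ = m := le_antisymm (heq ▸ hs₁.2) h1
    exact hcon (h2 ▸ hPm)
  obtain ⟨ε, hε, hgood⟩ := hr m hm0 hmlt hPm
  obtain ⟨b, hb, hbε⟩ := exists_lt_of_csInf_lt hne (show sInf B < m + ε by linarith)
  exact hb.2.2 (hgood b (csInf_le hbdd hb) hbε.le hb.2.1)

theorem mem_Ioo_of_midpoint {x w h : ℝ} (hw : w ≠ 0) (hh : 0 < h) (h0 : x ∈ Set.Icc (0 : ℝ) 1)
    (h2 : x - (2 * h) * w ∈ Set.Icc (0 : ℝ) 1) : x - h * w ∈ Set.Ioo (0 : ℝ) 1 := by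
  obtain ⟨a, b⟩ := h0
  obtain ⟨c, d⟩ := h2
  rcases lt_or_gt_of_ne hw with h' | h'
  · have := mul_neg_of_pos_of_neg hh h'
    constructor <;> linarith
  · have := mul_pos hh h'
    constructor <;> linarith

theorem not_opposite {x x' w ε ε' : ℝ} (hw : w ≠ 0) (hε : 0 < ε) (hε' : 0 < ε')
    (h : x + ε * w ∈ Set.Icc (0 : ℝ) 1) (h' : x' + ε' * w ∈ Set.Icc (0 : ℝ) 1) :
    ¬ (x = 0 ∧ x' = 1) := by
  rintro ⟨rfl, rfl⟩
  obtain ⟨a, b⟩ := h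
  obtain ⟨c, d⟩ := h'
  rcases lt_or_gt_of_ne hw with h' | h'
  · have := mul_neg_of_pos_of_neg hε h'
    linarith
  · have := mul_pos hε' h'
    linarith

/-- A geodesic that is at a point of a column continues straight ahead until it leaves the
column. -/
theorem IsGeodesic.eq_columnMk {γ : ℝ → LSurface} {v : Plane} (hγ : IsGeodesic γ v)
    (hvertex : ∀ t : ℝ, 0 ≤ t → ¬ IsVertex (γ t)) (hv0 : v 0 ≠ 0) (hv1 : v 1 ≠ 0) {t x y τ : ℝ}
    {i : Fin 3} (ht : 0 ≤ t) (hx : x ∈ Set.Icc (0 : ℝ) 1) (hτ : x + τ * v 0 ∈ Set.Icc (0 : ℝ) 1)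
    (h0 : γ t = columnMk i x y) :
    ∀ s ∈ Set.Icc 0 τ, γ (t + s) = columnMk i (x + s * v 0) (y + s * v 1) := by
  have hcol : ∀ s, 0 ≤ s → s ≤ τ → x + s * v 0 ∈ Set.Icc (0 : ℝ) 1 :=
    fun s h h' => add_mul_mem_Icc hx hτ ⟨h, h'⟩
  refine forall_mem_Icc_of_step (by simpa using h0) ?_ ?_
  · intro s hs hsτ hP
    obtain ⟨ε, i', x', y', hε, hεt, hback⟩ := hγ.backward_square (t := t + s) (by linarith)
    obtain ⟨n, ε₂, hε₂, hn⟩ := exists_int_add_mul_mem (y + s * v 1) (-v 1)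
    -- compare the two descriptions at a time `h` before, in the interior of a square
    obtain ⟨h, hh, hhε, hhε₂, hhs⟩ : ∃ h : ℝ, 0 < h ∧ 2 * h ≤ ε ∧ 2 * h ≤ ε₂ ∧ 2 * h ≤ s := by
      refine ⟨min ε (min ε₂ s) / 2, ?_, ?_, ?_, ?_⟩
      · have := lt_min hε (lt_min hε₂ hs)
        linarith
      · linarith [min_le_left ε (min ε₂ s)]
      · linarith [(min_le_right ε (min ε₂ s)).trans (min_le_left _ _)]
      · linarith [(min_le_right ε (min ε₂ s)).trans (min_le_right _ _)]
    have b0 := hback 0 ⟨le_rfl, hε.le⟩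
    have b1 := hback h ⟨hh.le, by linarith⟩
    have b2 := hback (2 * h) ⟨by linarith, hhε⟩
    simp only [zero_mul, sub_zero] at b0
    have n0 := hn 0 ⟨le_rfl, hε₂.le⟩
    have n1 := hn h ⟨hh.le, by linarith⟩
    have n2 := hn (2 * h) ⟨by linarith, hhε₂⟩
    rw [zero_mul, add_zero] at n0
    have c1 := hP (s - h) (by linarith) (by linarith)
    have en1 : y + s * v 1 + h * -v 1 - n = (y + s * v 1 - n) - h * v 1 := by ring
    have en2 : y + s * v 1 + 2 * h * -v 1 - n = (y + s * v 1 - n) - 2 * h * v 1 := by ring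
    have ex1 : x + (s - h) * v 0 = (x + s * v 0) - h * v 0 := by ring
    have ey1 : y + (s - h) * v 1 = y + s * v 1 + h * -v 1 := by ring
    rw [ey1, columnMk_eq _ _ n1, en1, ex1, ← add_sub_assoc, b1.2.2] at c1
    rw [en2] at n2
    have hX2 : (x + s * v 0) - 2 * h * v 0 ∈ Set.Icc (0 : ℝ) 1 := by
      have := hcol (s - 2 * h) (by linarith) (by linarith)
      rwa [show x + (s - 2 * h) * v 0 = (x + s * v 0) - 2 * h * v 0 by ring] at this
    have i1 := mem_Ioo_of_midpoint hv0 hh b0.1 b2.1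
    have i2 := mem_Ioo_of_midpoint hv1 hh b0.2.1 b2.2.1
    have i3 := mem_Ioo_of_midpoint hv0 hh (hcol s hs.le hsτ) hX2
    have i4 := mem_Ioo_of_midpoint hv1 hh n0 n2
    have hnv : ¬ IsVertex (squareMk i' (x' - h * v 0) (y' - h * v 1)) := by
      rw [← b1.2.2]
      exact hvertex _ (by linarith)
    obtain ⟨rfl, e2, e3⟩ := squareMk_inj (Set.Ioo_subset_Icc_self i1) (Set.Ioo_subset_Icc_self i3)
      (Set.Ioo_subset_Icc_self i2) (Set.Ioo_subset_Icc_self i4)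
      (fun h => i1.1.ne' h.1) (fun h => i1.2.ne h.1) (fun h => i2.1.ne' h.1)
      (fun h => i2.2.ne h.1) hnv c1
    rw [columnMk_eq _ _ n0, b0.2.2, sub_left_inj.1 e2, sub_left_inj.1 e3]
  · intro s hs hsτ hP
    obtain ⟨ε, i', x', y', hε, hforw⟩ := hγ.forward_square (t := t + s) (by linarith)
    obtain ⟨n, ε₂, hε₂, hn⟩ := exists_int_add_mul_mem (y + s * v 1) (v 1)
    have f0 := hforw 0 ⟨le_rfl, hε.le⟩
    have f1 := hforw ε ⟨hε.le, le_rfl⟩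
    simp only [zero_mul, add_zero] at f0
    have n0 := hn 0 ⟨le_rfl, hε₂.le⟩
    have n1 := hn ε₂ ⟨hε₂.le, le_rfl⟩
    rw [zero_mul, add_zero] at n0
    rw [columnMk_eq _ _ n0, f0.2.2] at hP
    have hX1 : (x + s * v 0) + (τ - s) * v 0 ∈ Set.Icc (0 : ℝ) 1 := by
      rwa [show (x + s * v 0) + (τ - s) * v 0 = x + τ * v 0 by ring]
    have hn1 : (y + s * v 1 - n) + ε₂ * v 1 ∈ Set.Icc (0 : ℝ) 1 := by
      rwa [show (y + s * v 1 - n) + ε₂ * v 1 = y + s * v 1 + ε₂ * v 1 - n by ring]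
    have hsτ' : 0 < τ - s := by linarith
    have hnv : ¬ IsVertex (squareMk i' x' y') := by
      rw [← f0.2.2]
      exact hvertex _ (by linarith)
    obtain ⟨rfl, rfl, rfl⟩ := squareMk_inj f0.1 (hcol s hs hsτ.le) f0.2.1 n0
      (not_opposite hv0 hε hsτ' f1.1 hX1) (fun h => not_opposite hv0 hsτ' hε hX1 f1.1 h.symm)
      (not_opposite hv1 hε hε₂ f1.2.1 hn1) (fun h => not_opposite hv1 hε₂ hε hn1 f1.2.1 h.symm)
      hnv hP
    refine ⟨min ε ε₂, lt_min hε hε₂, fun r hsr hrε hrτ => ?_⟩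
    have hr1 : r - s ≤ ε := by linarith [min_le_left ε ε₂]
    have hr2 : r - s ≤ ε₂ := by linarith [min_le_right ε ε₂]
    have hfr := (hforw (r - s) ⟨by linarith, hr1⟩).2.2
    have hnr := hn (r - s) ⟨by linarith, hr2⟩
    rw [show y + s * v 1 + (r - s) * v 1 - n = y + r * v 1 - n by ring] at hnr
    rw [columnMk_eq _ _ hnr, ← show t + s + (r - s) = t + r by ring, hfr]
    congr 1 <;> ring

/-- The abscissa in a column at distance `x` from the side through which a motion with horizontal
velocity `a` enters. -/
noncomputable def entryAbscissa (a x : ℝ) : ℝ := if 0 < a then x else 1 - x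

theorem entryAbscissa_entryAbscissa (a x : ℝ) : entryAbscissa a (entryAbscissa a x) = x := by
  unfold entryAbscissa
  split_ifs <;> ring

theorem entryAbscissa_mem (a : ℝ) {x : ℝ} (hx : x ∈ Set.Icc (0 : ℝ) 1) :
    entryAbscissa a x ∈ Set.Icc (0 : ℝ) 1 := by
  obtain ⟨h0, h1⟩ := hx
  unfold entryAbscissa
  split_ifs <;> constructor <;> linarith

theorem entryAbscissa_add {a : ℝ} (ha : a ≠ 0) (x : ℝ) :
    entryAbscissa a 0 + x / |a| * a = entryAbscissa a x := by
  unfold entryAbscissa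
  split_ifs with h
  · rw [abs_of_pos h]
    field_simp
    ring
  · rw [abs_of_neg (lt_of_le_of_ne (not_lt.1 h) ha)]
    field_simp
    ring

theorem columnMk_cross (a : ℝ) (i : Fin 3) (y : ℝ) :
    columnMk i (entryAbscissa a 1) y = columnMk (crossPerm ⌊y⌋ i) (entryAbscissa a 0) y := by
  unfold entryAbscissa
  split_ifs
  · exact columnMk_right i y
  · rw [sub_self, sub_zero]
    exact columnMk_left i y

section

variable {γ : ℝ → LSurface} {v : Plane}

theorem IsGeodesic.eq_columnMk_of_entry (hγ : IsGeodesic γ v)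
    (hvertex : ∀ t : ℝ, 0 ≤ t → ¬ IsVertex (γ t)) (hv0 : v 0 ≠ 0) (hv1 : v 1 ≠ 0) {t y : ℝ}
    {i : Fin 3} (ht : 0 ≤ t) (h0 : γ t = columnMk i (entryAbscissa (v 0) 0) y) {r : ℝ}
    (hr : r ∈ Set.Icc (0 : ℝ) 1) :
    γ (t + r / |v 0|) = columnMk i (entryAbscissa (v 0) r) (y + r * (v 1 / |v 0|)) := by
  have hb : 0 < |v 0| := abs_pos.2 hv0
  have h1 : entryAbscissa (v 0) 0 + 1 / |v 0| * v 0 ∈ Set.Icc (0 : ℝ) 1 := by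
    rw [entryAbscissa_add hv0]
    exact entryAbscissa_mem _ (by simp)
  rw [hγ.eq_columnMk hvertex hv0 hv1 ht (entryAbscissa_mem _ (by simp)) h1 h0 (r / |v 0|)
    ⟨div_nonneg hr.1 hb.le, by gcongr; exact hr.2⟩, entryAbscissa_add hv0]
  congr 2
  ring

/-- The column crossings of a geodesic follow the skew product. -/
theorem IsGeodesic.eq_columnMk_sheetPerm (hγ : IsGeodesic γ v)
    (hvertex : ∀ t : ℝ, 0 ≤ t → ¬ IsVertex (γ t)) (hv0 : v 0 ≠ 0) (hv1 : v 1 ≠ 0) {t y : ℝ}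
    {i : Fin 3} (ht : 0 ≤ t) (h0 : γ t = columnMk i (entryAbscissa (v 0) 0) y) (k : ℕ) :
    γ (t + k / |v 0|) = columnMk (sheetPerm (v 1 / |v 0|) y k i) (entryAbscissa (v 0) 0)
      (y + k * (v 1 / |v 0|)) := by
  induction k with
  | zero => simpa [sheetPerm] using h0
  | succ k ih =>
    have := hγ.eq_columnMk_of_entry hvertex hv0 hv1 (by positivity) ih (r := 1) (by simp)
    rw [columnMk_cross] at this
    have e1 : t + ((k + 1 : ℕ) : ℝ) / |v 0| = t + k / |v 0| + 1 / |v 0| := by push_cast; ring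
    have e2 : y + ((k + 1 : ℕ) : ℝ) * (v 1 / |v 0|) =
      y + k * (v 1 / |v 0|) + 1 * (v 1 / |v 0|) := by push_cast; ring
    have e3 : y + k * (v 1 / |v 0|) + 1 * (v 1 / |v 0|) = y + (k + 1) * (v 1 / |v 0|) := by ring
    rw [e1, e2, this, sheetPerm, e3]
    rfl

theorem IsGeodesic.exists_entry (hγ : IsGeodesic γ v)
    (hvertex : ∀ t : ℝ, 0 ≤ t → ¬ IsVertex (γ t)) (hv0 : v 0 ≠ 0) (hv1 : v 1 ≠ 0) :
    ∃ (t y : ℝ) (i : Fin 3), 0 ≤ t ∧ γ t = columnMk i (entryAbscissa (v 0) 0) y := by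
  obtain ⟨ε, i, x, y, hε, h⟩ := hγ.forward_square le_rfl
  obtain ⟨hx, hy, h0⟩ := h 0 ⟨le_rfl, hε.le⟩
  simp only [zero_mul, add_zero] at hx hy h0
  have h0' : γ 0 = columnMk i x y := by
    rw [columnMk_eq i x (n := 0) (by simpa using hy), h0]
    simp
  -- the time at which the first column is left
  set τ := (entryAbscissa (v 0) 1 - x) / v 0 with hτ
  have hτx : x + τ * v 0 = entryAbscissa (v 0) 1 := by
    rw [hτ]
    field_simp
    ring
  have hτ0 : 0 ≤ τ := by
    rw [hτ]
    unfold entryAbscissa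
    split_ifs with hpos
    · exact div_nonneg (by linarith [hx.2]) hpos.le
    · exact div_nonneg_of_nonpos (by linarith [hx.1]) (not_lt.1 hpos)
  refine ⟨τ, y + τ * v 1, crossPerm ⌊y + τ * v 1⌋ i, hτ0, ?_⟩
  have := hγ.eq_columnMk hvertex hv0 hv1 le_rfl hx
    (by rw [hτx]; exact entryAbscissa_mem _ (by simp)) h0' τ ⟨hτ0, le_rfl⟩
  rwa [zero_add, hτx, columnMk_cross] at this

end

/-! ### Vertical distances -/

theorem BrokenLine.vertical_square {a : LSurface} {l x y y' : ℝ} {i : Fin 3}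
    (h : BrokenLine a (squareMk i x y) l) (hx : x ∈ Set.Icc (0 : ℝ) 1)
    (hy : y ∈ Set.Icc (0 : ℝ) 1) (hy' : y' ∈ Set.Icc (0 : ℝ) 1) :
    BrokenLine a (squareMk i x y') (l + |y - y'|) := by
  rw [squareMk_eq i hx hy] at h
  rw [squareMk_eq i hx hy']
  have hseg : segment ℝ (squarePoint i x y) (squarePoint i x y') ⊆ LShape := by
    rintro _ ⟨a, b, ha, hb, hab, rfl⟩
    have hmem := convex_Icc (0 : ℝ) 1 hy hy' ha hb hab
    convert squarePoint_mem i hx hmem using 1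
    refine plane_ext ?_ ?_ <;> simp
    · linear_combination (cornerX i + x) * hab
    · linear_combination cornerY i * hab
  have hdist : dist (squarePoint i x y) (squarePoint i x y') = |y - y'| := by
    rw [EuclideanSpace.dist_eq, Fin.sum_univ_two]
    simp [Real.dist_eq, Real.sqrt_sq_eq_abs]
  rw [← hdist]
  exact BrokenLine.step ⟨squarePoint i x y, _⟩ ⟨squarePoint i x y', _⟩ l h hseg

theorem BrokenLine.vertical_column {a : LSurface} {l x y y' : ℝ} {i : Fin 3} (n : ℤ)
    (h : BrokenLine a (columnMk i x y) l) (hx : x ∈ Set.Icc (0 : ℝ) 1)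
    (hy : y - n ∈ Set.Icc (0 : ℝ) 1) (hy' : y' - n ∈ Set.Icc (0 : ℝ) 1) :
    BrokenLine a (columnMk i x y') (l + |y - y'|) := by
  rw [columnMk_eq _ _ hy] at h
  rw [columnMk_eq _ _ hy']
  have := h.vertical_square hx hy hy'
  rwa [sub_sub_sub_cancel_right] at this

theorem flatDist_columnMk_le {i : Fin 3} {x y z : ℝ} (hx : x ∈ Set.Icc (0 : ℝ) 1)
    (hz : z ∈ Set.Icc (0 : ℝ) 1) (hy : |y - z| ≤ 1) :
    flatDist (columnMk i x y) (columnMk i x z) ≤ |y - z| := by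
  refine csInf_le ⟨0, fun l hl => hl.nonneg⟩ ?_
  obtain ⟨h1, h2⟩ := abs_le.1 hy
  obtain ⟨z0, z1⟩ := hz
  change BrokenLine _ _ _
  rcases le_total y 0 with hy0 | hy0
  · have s1 := (BrokenLine.refl (x := columnMk i x y)).vertical_column (y' := 0) (-1) hx
      ⟨by push_cast; linarith, by push_cast; linarith⟩ (by simp)
    have s2 := s1.vertical_column (y' := z) 0 hx (by simp) ⟨by simpa, by simpa⟩
    convert s2 using 1
    rw [abs_of_nonpos (by linarith), abs_of_nonpos (by linarith), abs_of_nonpos (by linarith)]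
    ring
  · rcases le_total y 1 with hy1 | hy1
    · have s1 := (BrokenLine.refl (x := columnMk i x y)).vertical_column (y' := z) 0 hx
        ⟨by simpa, by simpa⟩ ⟨by simpa, by simpa⟩
      rwa [zero_add] at s1
    · have s1 := (BrokenLine.refl (x := columnMk i x y)).vertical_column (y' := 1) 1 hx
        ⟨by push_cast; linarith, by push_cast; linarith⟩ (by simp)
      have s2 := s1.vertical_column (y' := z) 0 hx (by simp) ⟨by simpa, by simpa⟩
      convert s2 using 1
      rw [abs_of_nonneg (by linarith), abs_of_nonneg (by linarith), abs_of_nonneg (by linarith)]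
      ring

theorem exists_eq_columnMk (P : LSurface) : ∃ (j : Fin 3) (x z : ℝ), x ∈ Set.Icc (0 : ℝ) 1 ∧
    z ∈ Set.Icc (0 : ℝ) 1 ∧ P = columnMk j x z := by
  induction P using Quot.ind with
  | mk p =>
  obtain ⟨p, hp⟩ := p
  obtain ⟨j, hj⟩ := mem_LShape_iff.1 hp
  obtain ⟨⟨h1, h2⟩, h3, h4⟩ := id hj
  have hz : p 1 - cornerY j ∈ Set.Icc (0 : ℝ) 1 := ⟨by linarith, by linarith⟩
  refine ⟨j, p 0 - cornerX j, p 1 - cornerY j, ⟨by linarith, by linarith⟩, hz, ?_⟩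
  rw [columnMk_eq _ _ (n := 0) (by simpa using hz)]
  rw [zpow_zero, Int.cast_zero, sub_zero]
  exact mk_eq_squareMk hp hj

end LSurf

/-! ### Superdensity -/

theorem theorem2 (γ : ℝ → LSurf.LSurface) (v : LSurf.Plane) (α : ℝ)
    (hγ : LSurf.IsGeodesic γ v)
    (hvertex : ∀ t : ℝ, 0 ≤ t → ¬ LSurf.IsVertex (γ t))
    (hslope : LSurf.HasSlope v α)
    (hα : LSurf.BadlyApproximable α) :
    LSurf.IsSuperdense γ := by
  obtain ⟨hv0, hv⟩ := hslope
  obtain ⟨c, hc, hcα⟩ := hα.exists_le_abs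
  have hirr := hα.1
  have hv1 : v 1 ≠ 0 := by
    intro h
    rw [h, zero_div] at hv
    exact hirr.ne_zero hv.symm
  set β := v 1 / |v 0| with hβ
  -- the rise per column is the slope, up to sign
  have hβα : β = α ∨ β = -α := by
    rcases lt_or_gt_of_ne hv0 with h | h
    · right
      rw [hβ, abs_of_neg h, ← hv, div_neg]
    · left
      rw [hβ, abs_of_pos h, hv]
  have hβirr : Irrational β := by
    rcases hβα with h | h <;> rw [h]
    · exact hirr
    · exact hirr.neg
  have hcβ : ∀ (q p : ℤ), 1 ≤ q → c / q ≤ |q * β - p| := by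
    intro q p hq
    rcases hβα with h | h <;> rw [h]
    · exact hcα q p hq
    · have := hcα q (-p) hq
      rw [← abs_neg]
      convert this using 2
      push_cast
      ring
  obtain ⟨t₀, y₀, i₀, ht₀, h₀⟩ := hγ.exists_entry hvertex hv0 hv1
  obtain ⟨M, hM⟩ := LSurf.exists_sheetPerm_eq_and_abs_le hβirr hcβ hc
  have hb : 0 < |v 0| := abs_pos.2 hv0
  refine ⟨t₀ + (2 * M + 1) / |v 0|, by positivity, fun n hn P => ?_⟩
  obtain ⟨j, x, z, hx, hz, rfl⟩ := LSurf.exists_eq_columnMk P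
  have hn1 : (1 : ℝ) ≤ n := by exact_mod_cast hn
  set r := LSurf.entryAbscissa (v 0) x with hr
  have hr01 : r ∈ Set.Icc (0 : ℝ) 1 := LSurf.entryAbscissa_mem _ hx
  have hrx : LSurf.entryAbscissa (v 0) r = x := LSurf.entryAbscissa_entryAbscissa _ _
  -- aim at the entry point of the line through `P` into its column
  obtain ⟨k, m, hk, hdist, hsheet⟩ := hM (2 * n) (by omega) y₀ (z - r * β) i₀ j
  have hγk := hγ.eq_columnMk_sheetPerm hvertex hv0 hv1 ht₀ h₀ k
  have hγr := hγ.eq_columnMk_of_entry hvertex hv0 hv1 (by positivity) hγk hr01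
  rw [hrx, LSurf.columnMk_add_int _ _ _ m, ← Equiv.Perm.mul_apply, hsheet] at hγr
  have hYz : |y₀ + k * β + r * β - m - z| ≤ 1 / (2 * n) := by
    rw [show y₀ + k * β + r * β - m - z = y₀ + k * β - m - (z - r * β) by ring]
    exact_mod_cast hdist
  have hlt : 1 / (2 * n : ℝ) < 1 / n := by
    apply one_div_lt_one_div_of_lt <;> linarith
  have hle : 1 / (n : ℝ) ≤ 1 := by
    rw [div_le_one (by linarith)]
    exact hn1
  refine ⟨t₀ + k / |v 0| + r / |v 0|, ?_, ?_, ?_⟩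
  · have := hr01.1
    positivity
  · have hkM : (k : ℝ) ≤ M * (2 * n) := by exact_mod_cast hk
    have h1 : k + r ≤ (2 * M + 1) * n := by
      have := hr01.2
      nlinarith
    calc t₀ + k / |v 0| + r / |v 0| = t₀ * 1 + (k + r) / |v 0| := by ring
      _ ≤ t₀ * n + ((2 * M + 1) * n) / |v 0| := by gcongr
      _ = (t₀ + (2 * M + 1) / |v 0|) * n := by ring
  · rw [hγr]
    exact (LSurf.flatDist_columnMk_le hx hz (hYz.trans (hlt.le.trans hle))).trans_lt
      (hYz.trans_lt hlt)
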